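/- Let $\Bbbk$ be an algebraically closed field of characteristic zero, and let $b$ be an integer such that $1<b<2b-2$ (equivalently $b\ge 3$). Let $\mathbb X\subset\mathbb P^2_{\Bbbk}$ be the standard $\Bbbk$-configuration of type $(1,b,2b-2)$, i.e. the set consisting of the point $[1:0:2]$, the $b$ points $[1:j:1]$ with $0\le j\le b-1$, and the $2b-2$ points $[1:j:0]$ with $0\le j\le 2b-3$. Let $I_{\mathbb X}\subset R=\Bbbk[x_0,x_1,x_2]$ be the homogeneous ideal of $\mathbb X$. For $t\ge 1$ let $I_{\mathbb X}^{(t)}=\bigcap_{P\in\operatorname{Ass}(R/I_{\mathbb X})}\bigl(I_{\mathbb X}^tR_P\cap R\bigr)$ be its $t$-th symbolic power, and let $\alpha(I_{\mathbb X}^{(t)})$ be the least degree of a nonzero homogeneous element of $I_{\mathbb X}^{(t)}$. Then the Waldschmidt constant $\widehat\alpha(I_{\mathbb X})=\lim_{t\to\infty}\alpha(I_{\mathbb X}^{(t)})/t$ exists and $$\widehat\alpha(I_{\mathbb X})=\frac{6b^2-14b+6}{2b^2-4b+1}.$$ -/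

import Mathlib

open Filter Topology MvPolynomial
open scoped LinearAlgebra.Projectivization

/-- The projective plane over `k`. -/
abbrev ProjPlane (k : Type*) [Field k] : Type _ := ℙ k (Fin 3 → k)

theorem affineChart_ne_zero {k : Type*} [Field k] (x y : k) : (![1, x, y] : Fin 3 → k) ≠ 0 := by
  intro h
  exact one_ne_zero (congrFun h 0)

/-- The point `[1 : x : y]` of the projective plane. -/
noncomputable def affPoint {k : Type*} [Field k] (x y : k) : ProjPlane k :=
  Projectivization.mk k ![1, x, y] (affineChart_ne_zero x y)

/-- `X` is the standard `k`-configuration of type `d = (d₁, …, d_s)`, where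
`1 ≤ d₁ < ⋯ < d_s`: it consists of the `dᵢ` points `[1 : j : s - i]`, `0 ≤ j ≤ dᵢ - 1`, on
the line `x₂ = (s - i) x₀`, for `i = 1, …, s`.  Since `Fin s` counts from `0`, the line of
`i : Fin s` is `x₂ = (s - 1 - i) x₀`. -/
structure IsStandardKConfiguration {k : Type*} [Field k] {s : ℕ} (d : Fin s → ℕ)
    (X : Set (ProjPlane k)) : Prop where
  one_le : ∀ i, 1 ≤ d i
  strictMono : StrictMono d
  eq_points : X = {P | ∃ (i : Fin s) (j : ℕ), j < d i ∧
    P = affPoint (j : k) ((s : k) - 1 - ((i : ℕ) : k))}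

/-- The homogeneous ideal of a set `X` of points of the projective plane: the ideal of
`k[x₀, x₁, x₂]` generated by the homogeneous polynomials vanishing at every point of `X`. -/
noncomputable def idealOfPoints {k : Type*} [Field k] (X : Set (ProjPlane k)) :
    Ideal (MvPolynomial (Fin 3) k) :=
  Ideal.span {f | (∃ n : ℕ, f.IsHomogeneous n) ∧
    ∀ (v : Fin 3 → k) (hv : v ≠ 0), Projectivization.mk k v hv ∈ X → eval v f = 0}

/-- The `t`-th symbolic power `I^(t) = ⋂_{P ∈ Ass(R/I)} (I^t R_P ∩ R)` of an ideal `I`. -/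
noncomputable def symbolicPow {R : Type*} [CommRing R] (I : Ideal R) (t : ℕ) : Ideal R :=
  ⨅ P : {P : Ideal R // P ∈ associatedPrimes R (R ⧸ I)},
    haveI : P.1.IsPrime := P.2.isPrime
    ((I ^ t).map (algebraMap R (Localization.AtPrime P.1))).comap
      (algebraMap R (Localization.AtPrime P.1))

/-- The initial degree `α(I)` of a homogeneous ideal `I`: the least degree of a nonzero
homogeneous element of `I`. -/
noncomputable def initialDegree {k : Type*} [Field k] (I : Ideal (MvPolynomial (Fin 3) k)) : ℕ :=
  sInf {n | ∃ f ∈ I, f ≠ 0 ∧ f.IsHomogeneous n}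

/-- `a` is the Waldschmidt constant of the homogeneous ideal `I`: the limit of
`α(I^(t)) / t` as `t → ∞` exists and equals `a`. -/
def HasWaldschmidtConstant {k : Type*} [Field k] (I : Ideal (MvPolynomial (Fin 3) k))
    (a : ℝ) : Prop :=
  Tendsto (fun t : ℕ => (initialDegree (symbolicPow I t) : ℝ) / (t : ℝ)) atTop (𝓝 a)

/-!
Write `e = b - 1`.  The points are `A = [1 : 0 : 2]`, `B_j = [1 : j : 1]` for `j ≤ e` and
`C_j = [1 : j : 0]` for `j < 2 e`; the claimed constant is `N / M` with `M = 2 e² - 1` and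
`N = 6 e² - 2 e - 2`.

A nonzero form lies in the `t`-th symbolic power of the ideal of the points exactly when it has
multiplicity at least `t` at each of them (`mem_symbolicPow_idealOfPoints_iff`), so the constant
compares degrees of curves with their multiplicities.  It is governed by the following curves of
negative self-intersection on the blow-up of the plane at the points: the lines `x₂ = 0` and
`x₂ = x₀`, the lines `A B_j C_{2 j}` for `j < e`, the line `A B_e`, and, for each `i < e`, a
rational curve of degree `e` with multiplicity `e - 1` at `A` through the `B_j`, `j ≠ i`, and the `C_j`
with `j` odd (`rationalCurve`).

*Upper bound.*  A suitable union of these curves has degree `N` and multiplicity at least `M` at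
each point (`extremalCurve`); its powers bound the initial degrees.

*Lower bound.*  There are weights `w_p ≥ 0` with `∑ w_p = e N` such that every form `F` of degree
`d` satisfies `∑ w_p mult_p F ≤ e M d` (`weightedMult_le`): they define a nef class on the blow-up,
orthogonal to the curves above.  By induction on `d`: a curve of the list that divides `F` is split
off.  Otherwise Bézout's inequality holds between `F` and each of these curves, and the claim is a
nonnegative combination of these inequalities (`weightedMult_le_of_not_dvd`).

Each curve of the list is rational, and Bézout's inequality is proved by substituting a
parametrisation into `F`: the result is a form that is divisible by pairwise coprime factors, one
for each point on the curve, raised to the multiplicity of `F` there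
(`pow_dvd_aeval_of_le_mult`), and it vanishes only if the curve divides `F`
(`dvd_of_aeval_eq_zero`).
-/

/-! ### Multiplicity of a form at a point -/

section Multiplicity

variable {k : Type*} [Field k]

theorem aeval_smul_of_isHomogeneous {σ S : Type*} [CommRing S] [Algebra k S]
    {F : MvPolynomial σ k} {n : ℕ} (hF : F.IsHomogeneous n) (c : S) (v : σ → S) :
    aeval (c • v) F = c ^ n * aeval v F := by
  rw [aeval_def, aeval_def, eval₂_eq, eval₂_eq, Finset.mul_sum]
  refine Finset.sum_congr rfl fun d hd => ?_
  have h : ∑ i ∈ d.support, d i = n := by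
    rw [← hF.degree_eq_sum_deg_support hd]
  simp only [Pi.smul_apply, smul_eq_mul, mul_pow, Finset.prod_mul_distrib,
    Finset.prod_pow_eq_pow_sum, h]
  ring

/-- The homomorphism `R → R[T]` that contracts the plane towards the point `p = [1 : a : b]`: it
fixes `x₀` and multiplies the two local parameters `x₁ - a x₀` and `x₂ - b x₀` by `T`.  The
coefficient of `T ^ m` is the part of order `m` of a polynomial at `p`. -/
noncomputable def contraction (p : k × k) :
    MvPolynomial (Fin 3) k →ₐ[k] Polynomial (MvPolynomial (Fin 3) k) :=
  aeval ![Polynomial.C (X 0),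
    Polynomial.C (C p.1 * X 0) + Polynomial.X * Polynomial.C (X 1 - C p.1 * X 0),
    Polynomial.C (C p.2 * X 0) + Polynomial.X * Polynomial.C (X 2 - C p.2 * X 0)]

/-- The multiplicity at `p = [1 : a : b]` of the curve `F = 0`, with junk value `0` at `F = 0`. -/
noncomputable def mult (p : k × k) (F : MvPolynomial (Fin 3) k) : ℕ :=
  (contraction p F).natTrailingDegree

/-- The homogeneous ideal of the point `[1 : a : b]`. -/
noncomputable def pointIdeal (p : k × k) : Ideal (MvPolynomial (Fin 3) k) :=
  Ideal.span {X 1 - C p.1 * X 0, X 2 - C p.2 * X 0}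

theorem eval_one_contraction (p : k × k) (F : MvPolynomial (Fin 3) k) :
    (contraction p F).eval 1 = F := by
  have : ((Polynomial.aeval (1 : MvPolynomial (Fin 3) k)).restrictScalars k).comp
      (contraction p) = AlgHom.id k _ := by
    apply MvPolynomial.algHom_ext
    intro i
    fin_cases i <;> simp [contraction]
  simpa [Polynomial.aeval_def, Polynomial.eval₂_eq_eval_map] using DFunLike.congr_fun this F

theorem contraction_ne_zero (p : k × k) {F : MvPolynomial (Fin 3) k} (hF : F ≠ 0) :
    contraction p F ≠ 0 := by
  intro h
  apply hF
  rw [← eval_one_contraction p F, h, Polynomial.eval_zero]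

theorem coeff_zero_contraction (p : k × k) (F : MvPolynomial (Fin 3) k) :
    (contraction p F).coeff 0 = aeval ![X 0, C p.1 * X 0, C p.2 * X 0] F := by
  have : ((Polynomial.aeval (0 : MvPolynomial (Fin 3) k)).restrictScalars k).comp
      (contraction p) = (aeval ![X 0, C p.1 * X 0, C p.2 * X 0] :
        MvPolynomial (Fin 3) k →ₐ[k] MvPolynomial (Fin 3) k) := by
    apply MvPolynomial.algHom_ext
    intro i
    fin_cases i <;> simp [contraction]
  rw [← DFunLike.congr_fun this F, Polynomial.coeff_zero_eq_eval_zero]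
  simp

theorem le_mult_iff_X_pow_dvd {p : k × k} {F : MvPolynomial (Fin 3) k} (hF : F ≠ 0) {m : ℕ} :
    m ≤ mult p F ↔ Polynomial.X ^ m ∣ contraction p F := by
  rw [Polynomial.X_pow_dvd_iff]
  constructor
  · intro h d hd
    exact Polynomial.coeff_eq_zero_of_lt_natTrailingDegree (lt_of_lt_of_le hd h)
  · intro h
    by_contra! hlt
    exact Polynomial.trailingCoeff_nonzero_iff_nonzero.mpr (contraction_ne_zero p hF) (h _ hlt)

theorem mult_mul (p : k × k) {F G : MvPolynomial (Fin 3) k} (hF : F ≠ 0) (hG : G ≠ 0) :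
    mult p (F * G) = mult p F + mult p G := by
  rw [mult, map_mul]
  exact Polynomial.natTrailingDegree_mul (contraction_ne_zero p hF) (contraction_ne_zero p hG)

theorem mult_one (p : k × k) : mult p (1 : MvPolynomial (Fin 3) k) = 0 := by
  simp [mult]

theorem mult_pow (p : k × k) {F : MvPolynomial (Fin 3) k} (hF : F ≠ 0) (n : ℕ) :
    mult p (F ^ n) = n * mult p F := by
  induction n with
  | zero => simp [mult_one]
  | succ n ih => rw [pow_succ, mult_mul p (pow_ne_zero n hF) hF, ih]; ring

theorem mult_prod (p : k × k) {ι : Type*} (s : Finset ι) (F : ι → MvPolynomial (Fin 3) k)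
    (hF : ∀ i ∈ s, F i ≠ 0) : mult p (∏ i ∈ s, F i) = ∑ i ∈ s, mult p (F i) := by
  classical
  induction s using Finset.induction_on with
  | empty => simp [mult_one]
  | insert a s ha ih =>
    have hs : ∀ i ∈ s, F i ≠ 0 := fun i hi => hF i (Finset.mem_insert_of_mem hi)
    rw [Finset.prod_insert ha, Finset.sum_insert ha, mult_mul p (hF a (Finset.mem_insert_self a s))
      (Finset.prod_ne_zero_iff.mpr hs), ih hs]

/-- Forms of multiplicity at least `m` at `p` vanish to order `m` along any parametrised curve
`g` that passes through `p` where `h = 0`. -/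
theorem pow_dvd_aeval_of_le_mult {p : k × k} {F : MvPolynomial (Fin 3) k} (hF : F ≠ 0) {m : ℕ}
    (hm : m ≤ mult p F) {g : Fin 3 → MvPolynomial (Fin 3) k} {h : MvPolynomial (Fin 3) k}
    (h1 : h ∣ g 1 - C p.1 * g 0) (h2 : h ∣ g 2 - C p.2 * g 0) : h ^ m ∣ aeval g F := by
  obtain ⟨q1, hq1⟩ := h1
  obtain ⟨q2, hq2⟩ := h2
  -- the substitution `g` factors through the contraction, with `T ↦ h`
  let θ : MvPolynomial (Fin 3) k →ₐ[k] MvPolynomial (Fin 3) k :=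
    aeval ![g 0, C p.1 * g 0 + q1, C p.2 * g 0 + q2]
  have key : (Polynomial.eval₂RingHom (θ : MvPolynomial (Fin 3) k →+* MvPolynomial (Fin 3) k)
      h).comp (contraction p : MvPolynomial (Fin 3) k →+* _) =
      (aeval g : MvPolynomial (Fin 3) k →ₐ[k] MvPolynomial (Fin 3) k) := by
    apply MvPolynomial.ringHom_ext
    · intro c
      simp [← MvPolynomial.algebraMap_eq, contraction]
    intro i
    fin_cases i
    · simp [contraction, θ]
    · simp [contraction, θ, ← hq1]
    · simp [contraction, θ, ← hq2]
  have h3 := map_dvd (Polynomial.eval₂RingHom (θ : MvPolynomial (Fin 3) k →+* _) h)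
    ((le_mult_iff_X_pow_dvd hF).mp hm)
  have h4 := DFunLike.congr_fun key F
  simp only [RingHom.comp_apply, RingHom.coe_coe] at h4
  rw [h4] at h3
  simpa using h3

/-- The contraction takes values in the Rees algebra of the ideal of the point. -/
theorem coeff_contraction_mem (p : k × k) (F : MvPolynomial (Fin 3) k) (i : ℕ) :
    (contraction p F).coeff i ∈ pointIdeal p ^ i := by
  suffices h : contraction p F ∈ reesAlgebra (pointIdeal p) from (mem_reesAlgebra_iff _ _).mp h i
  have hC : ∀ f : MvPolynomial (Fin 3) k, Polynomial.C f ∈ reesAlgebra (pointIdeal p) := fun f =>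
    (reesAlgebra (pointIdeal p)).algebraMap_mem f
  have hX : ∀ f ∈ pointIdeal p, Polynomial.X * Polynomial.C f ∈ reesAlgebra (pointIdeal p) := by
    intro f hf
    rw [Polynomial.X_mul_C, ← pow_one Polynomial.X, Polynomial.C_mul_X_pow_eq_monomial]
    exact reesAlgebra.monomial_mem.mpr (by simpa using hf)
  have h1 : (X 1 - C p.1 * X 0 : MvPolynomial (Fin 3) k) ∈ pointIdeal p :=
    Ideal.subset_span (by simp)
  have h2 : (X 2 - C p.2 * X 0 : MvPolynomial (Fin 3) k) ∈ pointIdeal p :=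
    Ideal.subset_span (by simp)
  induction F using MvPolynomial.induction_on with
  | C a =>
    rw [← MvPolynomial.algebraMap_eq, AlgHom.commutes]
    exact hC (algebraMap k _ a)
  | add f g hf hg => rw [map_add]; exact add_mem hf hg
  | mul_X f j hf =>
    rw [map_mul]
    refine mul_mem hf ?_
    rw [contraction, aeval_X]
    fin_cases j
    · exact hC (X 0)
    · exact add_mem (hC (C p.1 * X 0)) (hX _ h1)
    · exact add_mem (hC (C p.2 * X 0)) (hX _ h2)

theorem mem_pointIdeal_pow_of_le_mult {p : k × k} {F : MvPolynomial (Fin 3) k} {m : ℕ}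
    (hm : m ≤ mult p F) : F ∈ pointIdeal p ^ m := by
  rw [← eval_one_contraction p F, Polynomial.eval_eq_sum_range]
  refine Ideal.sum_mem _ fun i _ => ?_
  rcases lt_or_ge i m with hi | hi
  · rw [Polynomial.coeff_eq_zero_of_lt_natTrailingDegree (lt_of_lt_of_le hi hm)]
    simp
  · simpa using Ideal.pow_le_pow_right hi (coeff_contraction_mem p F i)

theorem X_dvd_contraction_of_mem {p : k × k} {F : MvPolynomial (Fin 3) k}
    (h : F ∈ pointIdeal p) : Polynomial.X ∣ contraction p F := by
  have : pointIdeal p ≤ (Ideal.span {Polynomial.X}).comap (contraction p) := by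
    refine Ideal.span_le.mpr ?_
    rintro f (rfl | rfl)
    all_goals
      rw [SetLike.mem_coe, Ideal.mem_comap, Ideal.mem_span_singleton, Polynomial.X_dvd_iff,
        coeff_zero_contraction]
      simp
  exact Ideal.mem_span_singleton.mp (this h)

theorem X_pow_dvd_contraction_of_mem {p : k × k} {F : MvPolynomial (Fin 3) k} {m : ℕ}
    (h : F ∈ pointIdeal p ^ m) : Polynomial.X ^ m ∣ contraction p F := by
  have h1 : pointIdeal p ≤ (Ideal.span {Polynomial.X}).comap (contraction p) := fun f hf =>
    Ideal.mem_span_singleton.mpr (X_dvd_contraction_of_mem hf)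
  have h2 := (Ideal.pow_right_mono h1 m).trans (Ideal.le_comap_pow (contraction p) m) h
  rwa [Ideal.mem_comap, Ideal.span_singleton_pow, Ideal.mem_span_singleton] at h2

theorem mem_pointIdeal_iff {p : k × k} {F : MvPolynomial (Fin 3) k} :
    F ∈ pointIdeal p ↔ aeval ![X 0, C p.1 * X 0, C p.2 * X 0] F =
      (0 : MvPolynomial (Fin 3) k) := by
  rw [← coeff_zero_contraction, ← Polynomial.X_dvd_iff]
  refine ⟨X_dvd_contraction_of_mem, fun h => ?_⟩
  by_cases hF : F = 0
  · simp [hF]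
  · simpa using mem_pointIdeal_pow_of_le_mult (m := 1)
      ((le_mult_iff_X_pow_dvd hF).mpr (by simpa using h))

instance pointIdeal_isPrime (p : k × k) : (pointIdeal p).IsPrime := by
  have : pointIdeal p = RingHom.ker (aeval ![X 0, C p.1 * X 0, C p.2 * X 0] :
      MvPolynomial (Fin 3) k →ₐ[k] MvPolynomial (Fin 3) k) := by
    ext F
    rw [mem_pointIdeal_iff, RingHom.mem_ker]
  rw [this]
  exact RingHom.ker_isPrime _

theorem eval_eq_zero_of_mem_pointIdeal {p : k × k} {F : MvPolynomial (Fin 3) k}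
    (h : F ∈ pointIdeal p) : eval ![1, p.1, p.2] F = 0 := by
  have h1 := congrArg (eval (fun _ => (1 : k))) (mem_pointIdeal_iff.mp h)
  rw [map_zero, ← MvPolynomial.coe_aeval_eq_eval, RingHom.coe_coe, ← AlgHom.comp_apply,
    MvPolynomial.comp_aeval] at h1
  rw [← h1, ← MvPolynomial.coe_aeval_eq_eval, RingHom.coe_coe]
  congr 2
  funext i
  fin_cases i <;> simp

theorem mem_pointIdeal_of_eval_eq_zero {p : k × k} {F : MvPolynomial (Fin 3) k} {n : ℕ}
    (hF : F.IsHomogeneous n) (h : eval ![1, p.1, p.2] F = 0) : F ∈ pointIdeal p := by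
  rw [mem_pointIdeal_iff]
  have h1 : (![X 0, C p.1 * X 0, C p.2 * X 0] : Fin 3 → MvPolynomial (Fin 3) k) =
      (X 0 : MvPolynomial (Fin 3) k) • fun i => C (![1, p.1, p.2] i) := by
    funext i
    fin_cases i <;> simp [mul_comm]
  have h2 : (aeval fun i => C (![1, p.1, p.2] i)) F = (C (eval ![1, p.1, p.2] F) :
      MvPolynomial (Fin 3) k) := by
    have := MvPolynomial.aeval_algebraMap_apply (MvPolynomial (Fin 3) k) ![1, p.1, p.2] F
    simpa [MvPolynomial.algebraMap_eq, Function.comp_def] using this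
  rw [h1, aeval_smul_of_isHomogeneous hF, h2, h, map_zero, mul_zero]

theorem one_le_mult {p : k × k} {F : MvPolynomial (Fin 3) k} {n : ℕ} (h0 : F ≠ 0)
    (hF : F.IsHomogeneous n) (h : eval ![1, p.1, p.2] F = 0) : 1 ≤ mult p F := by
  rw [le_mult_iff_X_pow_dvd h0, pow_one]
  exact X_dvd_contraction_of_mem (mem_pointIdeal_of_eval_eq_zero hF h)

theorem mult_eq_zero_of_notMem {p : k × k} {F : MvPolynomial (Fin 3) k} (h : F ∉ pointIdeal p) :
    mult p F = 0 := by
  by_contra hne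
  exact h (by simpa using mem_pointIdeal_pow_of_le_mult (Nat.one_le_iff_ne_zero.mpr hne))

theorem mult_le_totalDegree (p : k × k) (F : MvPolynomial (Fin 3) k) :
    mult p F ≤ F.totalDegree := by
  refine (Polynomial.natTrailingDegree_le_natDegree _).trans ?_
  rw [contraction, aeval_def, eval₂_eq]
  refine Polynomial.natDegree_sum_le_of_forall_le _ _ fun d hd => ?_
  refine Polynomial.natDegree_mul_le.trans ?_
  rw [IsScalarTower.algebraMap_apply k (MvPolynomial (Fin 3) k), Polynomial.algebraMap_eq,
    Polynomial.natDegree_C, zero_add]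
  refine (Polynomial.natDegree_prod_le _ _).trans (le_trans ?_ (le_totalDegree hd))
  refine Finset.sum_le_sum fun i _ => Polynomial.natDegree_pow_le.trans ?_
  refine mul_le_of_le_one_right (Nat.zero_le _) ?_
  fin_cases i
  · simp
  · exact Polynomial.natDegree_add_le_of_degree_le (by simp [-map_mul])
      (Polynomial.natDegree_mul_le.trans (by simp [-map_sub]))
  · exact Polynomial.natDegree_add_le_of_degree_le (by simp [-map_mul])
      (Polynomial.natDegree_mul_le.trans (by simp [-map_sub]))

end Multiplicity

/-! ### Symbolic powers of the ideal of a finite set of points -/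

section SymbolicPower

variable {k : Type*} [Field k]

/-- The set of points `[1 : a : b]` with `(a, b)` in `Z`. -/
def projPoints (Z : Finset (k × k)) : Set (ProjPlane k) :=
  {P | ∃ p ∈ Z, P = affPoint p.1 p.2}

theorem vanishes_on_projPoints_iff (Z : Finset (k × k)) {f : MvPolynomial (Fin 3) k} {n : ℕ}
    (hf : f.IsHomogeneous n) :
    (∀ (v : Fin 3 → k) (hv : v ≠ 0), Projectivization.mk k v hv ∈ projPoints Z →
      eval v f = 0) ↔ ∀ p ∈ Z, f ∈ pointIdeal p := by
  constructor
  · intro h p hp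
    exact mem_pointIdeal_of_eval_eq_zero hf (h _ (affineChart_ne_zero p.1 p.2) ⟨p, hp, rfl⟩)
  · rintro h v hv ⟨p, hp, hvp⟩
    obtain ⟨c, rfl⟩ :=
      (Projectivization.mk_eq_mk_iff' k _ _ hv (affineChart_ne_zero p.1 p.2)).mp hvp
    have := aeval_smul_of_isHomogeneous hf c ![1, p.1, p.2]
    rw [MvPolynomial.aeval_eq_eval, MvPolynomial.aeval_eq_eval] at this
    erw [this, eval_eq_zero_of_mem_pointIdeal (h p hp), mul_zero]

attribute [local instance] MvPolynomial.gradedAlgebra in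
theorem homogeneousComponent_mem_pointIdeal {p : k × k} {f : MvPolynomial (Fin 3) k}
    (hf : f ∈ pointIdeal p) (n : ℕ) : homogeneousComponent n f ∈ pointIdeal p := by
  refine MvPolynomial.homogeneousComponent_mem_of_mem ?_ hf n
  refine Ideal.homogeneous_span _ _ ?_
  rintro f (rfl | rfl)
  · exact ⟨1, (isHomogeneous_X k 1).sub (isHomogeneous_C_mul_X p.1 0)⟩
  · exact ⟨1, (isHomogeneous_X k 2).sub (isHomogeneous_C_mul_X p.2 0)⟩

theorem mem_idealOfPoints_iff (Z : Finset (k × k)) (f : MvPolynomial (Fin 3) k) :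
    f ∈ idealOfPoints (projPoints Z) ↔ ∀ p ∈ Z, f ∈ pointIdeal p := by
  constructor
  · intro hf p hp
    have hle : idealOfPoints (projPoints Z) ≤ pointIdeal p := by
      refine Ideal.span_le.mpr ?_
      rintro g ⟨⟨n, hn⟩, hg⟩
      exact (vanishes_on_projPoints_iff Z hn).mp hg p hp
    exact hle hf
  · intro hf
    rw [← sum_homogeneousComponent f]
    refine Ideal.sum_mem _ fun n _ =>
      Ideal.subset_span ⟨⟨n, homogeneousComponent_isHomogeneous n f⟩, ?_⟩
    rw [vanishes_on_projPoints_iff Z (homogeneousComponent_isHomogeneous n f)]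
    exact fun p hp => homogeneousComponent_mem_pointIdeal (hf p hp) n

/-- For each point of `Z` there is a polynomial vanishing at all the other points of `Z`, but not
at this one. -/
theorem exists_separator (Z : Finset (k × k)) (p : k × k) :
    ∃ s ∉ pointIdeal p, ∀ q ∈ Z, q ≠ p → s ∈ pointIdeal q := by
  classical
  have hline : ∀ q : k × k, ∃ l : MvPolynomial (Fin 3) k, l ∈ pointIdeal q ∧
      (q ≠ p → l ∉ pointIdeal p) := by
    intro q
    by_cases h1 : q.1 = p.1
    · refine ⟨X 2 - C q.2 * X 0, Ideal.subset_span (by simp), fun hne hmem => ?_⟩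
      have := eval_eq_zero_of_mem_pointIdeal hmem
      simp [sub_eq_zero] at this
      exact hne (Prod.ext h1 this.symm)
    · refine ⟨X 1 - C q.1 * X 0, Ideal.subset_span (by simp), fun _ hmem => ?_⟩
      have := eval_eq_zero_of_mem_pointIdeal hmem
      simp [sub_eq_zero] at this
      exact h1 this.symm
  choose l hl hlp using hline
  refine ⟨∏ q ∈ Z.erase p, l q, fun h => ?_, fun q hq hqp => ?_⟩
  · obtain ⟨q, hq, hmem⟩ := ((pointIdeal_isPrime p).prod_mem_iff).mp h
    exact hlp q (Finset.ne_of_mem_erase hq) hmem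
  · exact Ideal.mem_of_dvd _ (Finset.dvd_prod_of_mem l (Finset.mem_erase.mpr ⟨hqp, hq⟩)) (hl q)

theorem mem_colon_mk_iff {R : Type*} [CommRing R] (I : Ideal R) (r x : R) :
    r ∈ (⊥ : Submodule R (R ⧸ I)).colon {Ideal.Quotient.mk I x} ↔ r * x ∈ I := by
  rw [Submodule.mem_colon_singleton, Submodule.mem_bot, ← Ideal.Quotient.eq_zero_iff_mem, map_mul]
  rfl

theorem pointIdeal_mem_associatedPrimes {Z : Finset (k × k)} {p : k × k} (hp : p ∈ Z) :
    pointIdeal p ∈ associatedPrimes (MvPolynomial (Fin 3) k)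
      (MvPolynomial (Fin 3) k ⧸ idealOfPoints (projPoints Z)) := by
  obtain ⟨s, hsp, hs⟩ := exists_separator Z p
  rw [AssociatedPrimes.mem_iff, isAssociatedPrime_iff]
  refine ⟨inferInstance, Ideal.Quotient.mk _ s, ?_⟩
  ext r
  rw [mem_colon_mk_iff, mem_idealOfPoints_iff]
  constructor
  · intro hr q hq
    by_cases hqp : q = p
    · subst hqp
      exact Ideal.mul_mem_right _ _ hr
    · exact Ideal.mul_mem_left _ _ (hs q hq hqp)
  · intro h
    exact ((pointIdeal_isPrime p).mem_or_mem (h p hp)).resolve_right hsp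

theorem exists_le_pointIdeal_of_mem_associatedPrimes {Z : Finset (k × k)}
    {P : Ideal (MvPolynomial (Fin 3) k)}
    (hP : P ∈ associatedPrimes (MvPolynomial (Fin 3) k)
      (MvPolynomial (Fin 3) k ⧸ idealOfPoints (projPoints Z))) :
    ∃ p ∈ Z, P ≤ pointIdeal p := by
  rw [AssociatedPrimes.mem_iff, isAssociatedPrime_iff] at hP
  obtain ⟨hprime, x, hx⟩ := hP
  obtain ⟨x, rfl⟩ := Ideal.Quotient.mk_surjective x
  have hmem : ∀ r, r ∈ P ↔ ∀ p ∈ Z, r * x ∈ pointIdeal p := by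
    intro r
    rw [hx, mem_colon_mk_iff, mem_idealOfPoints_iff]
  have h1 : (1 : MvPolynomial (Fin 3) k) ∉ P := fun h =>
    hprime.ne_top ((Ideal.eq_top_iff_one P).mpr h)
  rw [hmem] at h1
  push Not at h1
  obtain ⟨p, hp, hxp⟩ := h1
  rw [one_mul] at hxp
  exact ⟨p, hp, fun r hr => ((pointIdeal_isPrime p).mem_or_mem ((hmem r).mp hr p hp)).resolve_right
    hxp⟩

/-- A nonzero polynomial lies in the `t`-th symbolic power of the ideal of a finite set of points
exactly when it has multiplicity at least `t` at each of them. -/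
theorem mem_symbolicPow_idealOfPoints_iff {Z : Finset (k × k)} {F : MvPolynomial (Fin 3) k}
    (hF : F ≠ 0) (t : ℕ) :
    F ∈ symbolicPow (idealOfPoints (projPoints Z)) t ↔ ∀ p ∈ Z, t ≤ mult p F := by
  simp only [symbolicPow, Ideal.mem_iInf, Ideal.mem_comap]
  constructor
  · intro h p hp
    have h1 := h ⟨pointIdeal p, pointIdeal_mem_associatedPrimes hp⟩
    obtain ⟨s, hs, hsF⟩ := (IsLocalization.algebraMap_mem_map_algebraMap_iff
      (pointIdeal p).primeCompl _ _ _).mp h1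
    have hs0 : s ≠ 0 := by
      rintro rfl
      exact hs (zero_mem _)
    have hle : idealOfPoints (projPoints Z) ≤ pointIdeal p := fun f hf =>
      (mem_idealOfPoints_iff Z f).mp hf p hp
    have h2 := (le_mult_iff_X_pow_dvd (mul_ne_zero hs0 hF)).mpr
      (X_pow_dvd_contraction_of_mem (Ideal.pow_right_mono hle t hsF))
    rwa [mult_mul p hs0 hF, mult_eq_zero_of_notMem hs, zero_add] at h2
  · rintro h ⟨P, hP⟩
    obtain ⟨p, hp, hPp⟩ := exists_le_pointIdeal_of_mem_associatedPrimes hP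
    have := hP.isPrime
    obtain ⟨s, hsp, hs⟩ := exists_separator Z p
    refine (IsLocalization.algebraMap_mem_map_algebraMap_iff P.primeCompl _ _ _).mpr
      ⟨s ^ t, fun hst => hsp (hPp (this.mem_of_pow_mem t hst)), ?_⟩
    have hle : Ideal.span {s} * pointIdeal p ≤ idealOfPoints (projPoints Z) := by
      rw [Ideal.mul_le]
      intro a ha c hc
      rw [mem_idealOfPoints_iff]
      intro q hq
      by_cases hqp : q = p
      · subst hqp
        exact Ideal.mul_mem_left _ _ hc
      · exact Ideal.mul_mem_right _ _
          ((Ideal.span_singleton_le_iff_mem (pointIdeal q)).mpr (hs q hq hqp) ha)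
    refine Ideal.pow_right_mono hle t ?_
    rw [mul_pow]
    exact Ideal.mul_mem_mul (Ideal.pow_mem_pow (Ideal.mem_span_singleton_self s) t)
      (mem_pointIdeal_pow_of_le_mult (h p hp))

/-- The Waldschmidt constant of a finite set of points is `N / M` when every curve satisfies
`deg ≥ (N / M) t` as soon as it has multiplicity `≥ t` at each point, and some curve of degree `N`
has multiplicity `≥ M` at each point. -/
theorem hasWaldschmidtConstant_of_extremal {Z : Finset (k × k)} {M N : ℕ} (hM : 0 < M)
    {H : MvPolynomial (Fin 3) k} (hH0 : H ≠ 0) (hH : H.IsHomogeneous N)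
    (hHm : ∀ p ∈ Z, M ≤ mult p H)
    (hlow : ∀ (F : MvPolynomial (Fin 3) k) (d t : ℕ), F ≠ 0 → F.IsHomogeneous d →
      (∀ p ∈ Z, t ≤ mult p F) → t * N ≤ M * d) :
    HasWaldschmidtConstant (idealOfPoints (projPoints Z)) ((N : ℝ) / M) := by
  have hMr : (0 : ℝ) < M := by exact_mod_cast hM
  have hupper : ∀ t : ℕ, ∃ F ∈ symbolicPow (idealOfPoints (projPoints Z)) t,
      F ≠ 0 ∧ F.IsHomogeneous (N * (t / M + 1)) := by
    intro t
    refine ⟨H ^ (t / M + 1), ?_, pow_ne_zero _ hH0, hH.pow _⟩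
    rw [mem_symbolicPow_idealOfPoints_iff (pow_ne_zero _ hH0)]
    intro p hp
    rw [mult_pow p hH0]
    calc t ≤ (t / M + 1) * M := by
          rw [mul_comm]; exact (Nat.lt_mul_div_succ t hM).le
      _ ≤ _ := Nat.mul_le_mul_left _ (hHm p hp)
  have hle : ∀ t : ℕ, initialDegree (symbolicPow (idealOfPoints (projPoints Z)) t) ≤
      N * (t / M + 1) := fun t => Nat.sInf_le (hupper t)
  have hge : ∀ t : ℕ, t * N ≤
      M * initialDegree (symbolicPow (idealOfPoints (projPoints Z)) t) := by
    intro t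
    obtain ⟨F, hF, hF0, hFd⟩ := Nat.sInf_mem (s := {n | ∃ f ∈ symbolicPow (idealOfPoints
      (projPoints Z)) t, f ≠ 0 ∧ f.IsHomogeneous n}) ⟨_, hupper t⟩
    exact hlow F _ t hF0 hFd ((mem_symbolicPow_idealOfPoints_iff hF0 t).mp hF)
  have hlim : Tendsto (fun t : ℕ => (N : ℝ) / M + N / t) atTop (𝓝 ((N : ℝ) / M)) := by
    simpa using (tendsto_const_nhds (x := (N : ℝ) / M)).add
      (tendsto_const_div_atTop_nhds_zero_nat (N : ℝ))
  refine tendsto_of_tendsto_of_tendsto_of_le_of_le' tendsto_const_nhds hlim ?_ ?_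
  · filter_upwards [eventually_gt_atTop 0] with t ht
    have htr : (0 : ℝ) < t := by exact_mod_cast ht
    rw [div_le_div_iff₀ hMr htr, mul_comm, mul_comm _ (M : ℝ)]
    exact_mod_cast hge t
  · filter_upwards [eventually_gt_atTop 0] with t ht
    have htr : (0 : ℝ) < t := by exact_mod_cast ht
    have h1 : (initialDegree (symbolicPow (idealOfPoints (projPoints Z)) t) : ℝ) ≤
        N * ((t : ℝ) / M + 1) := by
      refine le_trans (Nat.cast_le.mpr (hle t)) ?_
      push_cast
      gcongr
      exact Nat.cast_div_le
    rw [div_le_iff₀ htr]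
    refine h1.trans (le_of_eq ?_)
    field_simp

end SymbolicPower

/-! ### Bézout inequalities along parametrised curves -/

section Bezout

variable {k : Type*} [Field k]

theorem irreducible_of_isHomogeneous_one {σ : Type*} {h : MvPolynomial σ k}
    (hh : h.IsHomogeneous 1) (h0 : h ≠ 0) : Irreducible h := by
  refine irreducible_of_totalDegree_eq_one (hh.totalDegree h0) fun x hx => ?_
  obtain ⟨d, hd⟩ := MvPolynomial.ne_zero_iff.mp h0
  exact isUnit_of_dvd_unit (hx d) (isUnit_iff_ne_zero.mpr hd)

theorem isRelPrime_of_eval_ne_zero {σ : Type*} {h q : MvPolynomial σ k}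
    (hh : h.IsHomogeneous 1) (h0 : h ≠ 0) (v : σ → k) (hv : eval v h = 0) (hq : eval v q ≠ 0) :
    IsRelPrime h q := by
  rw [(irreducible_of_isHomogeneous_one hh h0).isRelPrime_iff_not_dvd]
  intro hdvd
  have := map_dvd (eval v) hdvd
  rw [hv, zero_dvd_iff] at this
  exact hq this

theorem not_dvd_of_eval_ne_zero {σ : Type*} {h q : MvPolynomial σ k}
    (v : σ → k) (hv : eval v h = 0) (hq : eval v q ≠ 0) : ¬ h ∣ q := by
  intro hdvd
  have := map_dvd (eval v) hdvd
  rw [hv, zero_dvd_iff] at this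
  exact hq this

theorem isHomogeneous_of_mul_left {σ : Type*} {f G : MvPolynomial σ k} {e d : ℕ}
    (hf : f.IsHomogeneous e) (hf0 : f ≠ 0) (hG0 : G ≠ 0) (hfG : (f * G).IsHomogeneous d) :
    ∃ n, d = e + n ∧ G.IsHomogeneous n := by
  have hcomp : ∀ j, homogeneousComponent (e + j) (f * G) = f * homogeneousComponent j G := by
    intro j
    conv_lhs => rw [← sum_homogeneousComponent G, Finset.mul_sum, map_sum]
    simp_rw [homogeneousComponent_of_mem (hf.mul (homogeneousComponent_isHomogeneous _ G))]
    simp only [add_right_inj]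
    rw [Finset.sum_ite_eq]
    split_ifs with h
    · rfl
    · rw [homogeneousComponent_eq_zero _ _ (by simpa using h), mul_zero]
  have hzero : ∀ j, e + j ≠ d → homogeneousComponent j G = 0 := by
    intro j hj
    have := hcomp j
    rw [homogeneousComponent_of_mem hfG, if_neg hj] at this
    exact (mul_eq_zero.mp this.symm).resolve_left hf0
  obtain ⟨j, hj⟩ : ∃ j, homogeneousComponent j G ≠ 0 := by
    by_contra! hall
    apply hG0
    rw [← sum_homogeneousComponent G]
    exact Finset.sum_eq_zero fun j _ => hall j
  have hd : e + j = d := by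
    by_contra hne
    exact hj (hzero j hne)
  refine ⟨j, hd.symm, ?_⟩
  have : G = homogeneousComponent j G := by
    conv_lhs => rw [← sum_homogeneousComponent G]
    refine Finset.sum_eq_single j (fun i _ hij => hzero i (by omega)) fun hnot => ?_
    exact homogeneousComponent_eq_zero _ _ (by simpa using hnot)
  rw [this]
  exact homogeneousComponent_isHomogeneous j G

/-- If the curve `f = 0` is parametrised by `g`, up to the factor `P`, then a form vanishing
identically along `g` is a multiple of `f`. -/
theorem dvd_of_aeval_eq_zero {σ : Type*} {f P F : MvPolynomial σ k}
    {g : σ → MvPolynomial σ k} (hfP : IsRelPrime f P) (hg : ∀ i, f ∣ P * X i - g i) {d : ℕ}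
    (hF : F.IsHomogeneous d) (h : aeval g F = 0) : f ∣ F := by
  have h1 : f ∣ P ^ d * F := by
    rw [← Ideal.mem_span_singleton, ← Ideal.Quotient.eq_zero_iff_mem]
    have h2 : P ^ d * F = aeval (P • (X : σ → MvPolynomial σ k)) F := by
      rw [aeval_smul_of_isHomogeneous hF, aeval_X_left_apply]
    have h3 : ∀ v : σ → MvPolynomial σ k, Ideal.Quotient.mk (Ideal.span {f}) (aeval v F) =
        aeval (fun i => Ideal.Quotient.mk (Ideal.span {f}) (v i)) F := fun v => by
      have := MvPolynomial.comp_aeval_apply v (Ideal.Quotient.mkₐ k (Ideal.span {f})) F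
      simpa using this
    rw [h2, h3, ← map_zero (Ideal.Quotient.mk (Ideal.span {f})), ← h, h3]
    congr 2
    funext i
    exact Ideal.Quotient.eq.mpr (Ideal.mem_span_singleton.mpr (hg i))
  exact IsRelPrime.dvd_of_dvd_mul_left (IsRelPrime.pow_right hfP) h1

theorem totalDegree_le_of_dvd_aeval {σ : Type*} {f P F D : MvPolynomial σ k}
    {g : σ → MvPolynomial σ k} (hfP : IsRelPrime f P) (hg : ∀ i, f ∣ P * X i - g i) {d e : ℕ}
    (hF : F.IsHomogeneous d) (hge : ∀ i, (g i).IsHomogeneous e) (hfF : ¬ f ∣ F)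
    (hD : D ∣ aeval g F) : D.totalDegree ≤ e * d := by
  have h0 : aeval g F ≠ 0 := fun h => hfF (dvd_of_aeval_eq_zero hfP hg hF h)
  obtain ⟨q, hq⟩ := hD
  have h1 := (hF.aeval g hge).totalDegree h0
  rw [hq, totalDegree_mul_of_isDomain (left_ne_zero_of_mul (hq ▸ h0))
    (right_ne_zero_of_mul (hq ▸ h0))] at h1
  omega

theorem totalDegree_pow_of_isHomogeneous {h : MvPolynomial (Fin 3) k} {e : ℕ}
    (hh : h.IsHomogeneous e) (h0 : h ≠ 0) (m : ℕ) : (h ^ m).totalDegree = e * m :=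
  (hh.pow m).totalDegree (pow_ne_zero m h0)

theorem totalDegree_prod_pow {ι : Type*} (s : Finset ι) {h : ι → MvPolynomial (Fin 3) k}
    (hh : ∀ i, (h i).IsHomogeneous 1) (h0 : ∀ i, h i ≠ 0) (m : ι → ℕ) :
    (∏ i ∈ s, h i ^ m i).totalDegree = ∑ i ∈ s, m i := by
  refine (IsHomogeneous.prod s _ _ fun i _ => ?_).totalDegree
    (Finset.prod_ne_zero_iff.mpr fun i _ => pow_ne_zero _ (h0 i))
  simpa using (hh i).pow (m i)

/-- The line `x₂ = c x₀`. -/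
noncomputable def horizontalLine (c : k) : MvPolynomial (Fin 3) k := X 2 - C c * X 0

/-- The line through the points `[1 : 0 : 2]`, `[1 : c : 1]` and `[1 : 2 c : 0]`. -/
noncomputable def pencilLine (c : k) : MvPolynomial (Fin 3) k := X 1 + C c * horizontalLine 2

theorem horizontalLine_isHomogeneous (c : k) : (horizontalLine c).IsHomogeneous 1 :=
  (isHomogeneous_X k 2).sub (isHomogeneous_C_mul_X c 0)

theorem pencilLine_isHomogeneous (c : k) : (pencilLine c).IsHomogeneous 1 :=
  (isHomogeneous_X k 1).add ((horizontalLine_isHomogeneous 2).C_mul c)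

@[simp] theorem eval_horizontalLine (c : k) (v : Fin 3 → k) :
    eval v (horizontalLine c) = v 2 - c * v 0 := by
  simp [horizontalLine]

@[simp] theorem eval_pencilLine (c : k) (v : Fin 3 → k) :
    eval v (pencilLine c) = v 1 + c * (v 2 - 2 * v 0) := by
  simp [pencilLine]

theorem horizontalLine_ne_zero (c : k) : horizontalLine c ≠ 0 := fun h => by
  simpa using congrArg (eval ![0, 0, 1]) h

theorem pencilLine_ne_zero (c : k) : pencilLine c ≠ 0 := fun h => by
  simpa using congrArg (eval ![0, 1, 0]) h

theorem mult_line_le_one {l : MvPolynomial (Fin 3) k} (hl : l.IsHomogeneous 1) (p : k × k) :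
    mult p l ≤ 1 :=
  (mult_le_totalDegree p l).trans hl.totalDegree_le

theorem mult_eq_zero_of_eval_ne_zero {p : k × k} {F : MvPolynomial (Fin 3) k}
    (h : eval ![1, p.1, p.2] F ≠ 0) : mult p F = 0 :=
  mult_eq_zero_of_notMem fun hmem => h (eval_eq_zero_of_mem_pointIdeal hmem)

theorem mult_middle_pencilLine_eq_zero {c c' : k} (h : c ≠ c') :
    mult (c, 1) (pencilLine c') = 0 := by
  refine mult_eq_zero_of_eval_ne_zero ?_
  simp only [eval_pencilLine, Matrix.cons_val]
  exact fun h0 => h (by linear_combination h0)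

theorem mult_bottom_pencilLine_eq_zero {c c' : k} (h : c ≠ 2 * c') :
    mult (c, 0) (pencilLine c') = 0 := by
  refine mult_eq_zero_of_eval_ne_zero ?_
  simp only [eval_pencilLine, Matrix.cons_val]
  exact fun h0 => h (by linear_combination h0)

theorem one_le_mult_horizontalLine (x c : k) : 1 ≤ mult (x, c) (horizontalLine c) :=
  one_le_mult (horizontalLine_ne_zero c) (horizontalLine_isHomogeneous c) (by simp)

theorem one_le_mult_pencilLine_top (c : k) : 1 ≤ mult (0, 2) (pencilLine c) :=
  one_le_mult (pencilLine_ne_zero c) (pencilLine_isHomogeneous c) (by simp)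

theorem one_le_mult_pencilLine_middle (c : k) : 1 ≤ mult (c, 1) (pencilLine c) :=
  one_le_mult (pencilLine_ne_zero c) (pencilLine_isHomogeneous c) (by simp; ring)

theorem one_le_mult_pencilLine_bottom (c : k) : 1 ≤ mult (2 * c, 0) (pencilLine c) :=
  one_le_mult (pencilLine_ne_zero c) (pencilLine_isHomogeneous c) (by simp; ring)

theorem bezout_horizontalLine (c : k) {F : MvPolynomial (Fin 3) k} {d : ℕ}
    (hF : F.IsHomogeneous d) (hndvd : ¬ horizontalLine c ∣ F) (s : Finset k) :
    ∑ a ∈ s, mult (a, c) F ≤ d := by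
  have hF0 : F ≠ 0 := by
    rintro rfl
    exact hndvd (dvd_zero _)
  let h : k → MvPolynomial (Fin 3) k := fun a => X 1 - C a * X 0
  have hh : ∀ a, (h a).IsHomogeneous 1 := fun a =>
    (isHomogeneous_X k 1).sub (isHomogeneous_C_mul_X a 0)
  have hh0 : ∀ a, h a ≠ 0 := fun a ha => by
    simpa [h] using congrArg (eval ![0, 1, 0]) ha
  rw [← totalDegree_prod_pow s hh hh0 fun a => mult (a, c) F, ← one_mul d]
  refine totalDegree_le_of_dvd_aeval (P := 1) (g := ![X 0, X 1, C c * X 0]) isRelPrime_one_right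
    ?_ hF ?_ hndvd ?_
  · intro i
    fin_cases i <;> simp [horizontalLine]
  · intro i
    fin_cases i
    · exact isHomogeneous_X k 0
    · exact isHomogeneous_X k 1
    · exact isHomogeneous_C_mul_X c 0
  · refine Finset.prod_dvd_of_isRelPrime (fun a _ a' _ haa' => ?_) fun a _ => ?_
    · refine (isRelPrime_of_eval_ne_zero (hh a) (hh0 a) ![1, a, 0] ?_ ?_).pow
      · simp [h]
      · simpa [h, sub_eq_zero] using haa'
    · exact pow_dvd_aeval_of_le_mult hF0 le_rfl (by simp [h]) (by simp)

theorem bezout_pencilLine [CharZero k] (c : k) {F : MvPolynomial (Fin 3) k} {d : ℕ}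
    (hF : F.IsHomogeneous d) (hndvd : ¬ pencilLine c ∣ F) :
    mult (0, 2) F + mult (c, 1) F + mult (2 * c, 0) F ≤ d := by
  have hF0 : F ≠ 0 := by
    rintro rfl
    exact hndvd (dvd_zero _)
  have hrel : ∀ a a' : k, a ≠ a' → IsRelPrime (horizontalLine a) (horizontalLine a') := by
    intro a a' haa'
    refine isRelPrime_of_eval_ne_zero (horizontalLine_isHomogeneous a) (horizontalLine_ne_zero a)
      ![1, 0, a] ?_ ?_
    · simp
    · simpa [sub_eq_zero] using haa'
  have hdvd : horizontalLine 2 ^ mult (0, 2) F * horizontalLine 1 ^ mult (c, 1) F *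
      horizontalLine 0 ^ mult (2 * c, 0) F ∣
        aeval ![X 0, - C c * horizontalLine 2, X 2] F := by
    refine IsRelPrime.mul_dvd (IsRelPrime.mul_left ?_ ?_) (IsRelPrime.mul_dvd ?_ ?_ ?_) ?_
    · exact (hrel 2 0 (by norm_num)).pow
    · exact (hrel 1 0 (by norm_num)).pow
    · exact (hrel 2 1 (by norm_num)).pow
    · refine pow_dvd_aeval_of_le_mult hF0 le_rfl ?_ ?_
      · exact ⟨- C c, by simp; ring⟩
      · exact ⟨1, by simp [horizontalLine]⟩
    · refine pow_dvd_aeval_of_le_mult hF0 le_rfl ?_ ?_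
      · exact ⟨- C c, by simp [horizontalLine, map_ofNat]; ring⟩
      · exact ⟨1, by simp [horizontalLine]⟩
    · refine pow_dvd_aeval_of_le_mult hF0 le_rfl ?_ ?_
      · exact ⟨- C c, by simp [horizontalLine, map_ofNat]; ring⟩
      · exact ⟨1, by simp [horizontalLine]⟩
  have h := totalDegree_le_of_dvd_aeval (P := 1) (e := 1) isRelPrime_one_right ?_ hF ?_ hndvd hdvd
  · have hne : ∀ (a : k) (m : ℕ), horizontalLine a ^ m ≠ 0 := fun a m =>
      pow_ne_zero m (horizontalLine_ne_zero a)
    rw [totalDegree_mul_of_isDomain (mul_ne_zero (hne _ _) (hne _ _)) (hne _ _),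
      totalDegree_mul_of_isDomain (hne _ _) (hne _ _)] at h
    simp only [totalDegree_pow_of_isHomogeneous (horizontalLine_isHomogeneous _)
      (horizontalLine_ne_zero _)] at h
    omega
  · intro i
    fin_cases i <;> simp [pencilLine]
  · intro i
    fin_cases i
    · exact isHomogeneous_X k 0
    · simpa using (horizontalLine_isHomogeneous (2 : k)).C_mul (-c)
    · exact isHomogeneous_X k 2

end Bezout

/-! ### Rational curves with one multiple point -/

section RationalCurve

variable {k : Type*} [Field k]

/-- The product of the lines of the pencil through `[1 : 0 : 2]` with parameters in `S`. -/
noncomputable def pencilProd (S : Finset k) : MvPolynomial (Fin 3) k := ∏ c ∈ S, pencilLine c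

theorem pencilProd_isHomogeneous (S : Finset k) : (pencilProd S).IsHomogeneous S.card := by
  simpa [pencilProd] using IsHomogeneous.prod S (fun c => pencilLine c) (fun _ => 1)
    fun c _ => pencilLine_isHomogeneous c

theorem eval_pencilProd_eq_zero {S : Finset k} {c : k} (hc : c ∈ S) {v : Fin 3 → k}
    (hv : v 1 + c * (v 2 - 2 * v 0) = 0) : eval v (pencilProd S) = 0 := by
  rw [pencilProd, map_prod]
  exact Finset.prod_eq_zero hc (by simpa using hv)

theorem eval_pencilProd_ne_zero {S : Finset k} {c : k} (hc : c ∉ S) {v : Fin 3 → k}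
    (hv : v 1 + c * (v 2 - 2 * v 0) = 0) (hr : v 2 - 2 * v 0 ≠ 0) :
    eval v (pencilProd S) ≠ 0 := by
  rw [pencilProd, map_prod, Finset.prod_ne_zero_iff]
  intro c' hc' h0
  rw [eval_pencilLine] at h0
  have h1 : (c' - c) * (v 2 - 2 * v 0) = 0 := by linear_combination h0 - hv
  rcases mul_eq_zero.mp h1 with h | h
  · exact hc (sub_eq_zero.mp h ▸ hc')
  · exact hr h

theorem card_le_mult_pencilProd (S : Finset k) : S.card ≤ mult (0, 2) (pencilProd S) := by
  rw [pencilProd, mult_prod _ _ _ fun c _ => pencilLine_ne_zero c, Finset.card_eq_sum_ones]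
  exact Finset.sum_le_sum fun c _ => one_le_mult (pencilLine_ne_zero c)
    (pencilLine_isHomogeneous c) (by simp)

/-- `P` is the quotient of `∏_T - ∏_S` by the line `x₂ = 2 x₀`, where `S`, `T` are disjoint sets of
`e ≥ 1` parameters of the pencil through `A = [1 : 0 : 2]`.  The corresponding rational curve
`x₂ P + ∏_T = 0` has degree `e` and multiplicity `e - 1` at `A`, meets the line `x₂ = x₀` where the
lines of `S` do, and the line `x₂ = 0` where the lines of `T` do. -/
structure IsPencilQuotient (S T : Finset k) (P : MvPolynomial (Fin 3) k) : Prop where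
  disjoint : Disjoint S T
  card_eq : S.card = T.card
  nonempty : S.Nonempty
  mul_eq : horizontalLine 2 * P = pencilProd T - pencilProd S

/-- The rational curve `x₂ P + ∏_T = 0`. -/
noncomputable def rationalCurve (T : Finset k) (P : MvPolynomial (Fin 3) k) :
    MvPolynomial (Fin 3) k := X 2 * P + pencilProd T

theorem exists_isPencilQuotient {S T : Finset k} (hST : Disjoint S T) (hcard : S.card = T.card)
    (hS : S.Nonempty) : ∃ P, IsPencilQuotient S T P := by
  suffices h : horizontalLine 2 ∣ pencilProd T - pencilProd S by
    obtain ⟨P, hP⟩ := h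
    exact ⟨P, hST, hcard, hS, hP.symm⟩
  rw [← Ideal.mem_span_singleton, ← Ideal.Quotient.eq, pencilProd, pencilProd, map_prod, map_prod]
  have h : ∀ c : k, Ideal.Quotient.mk (Ideal.span {horizontalLine (2 : k)}) (pencilLine c) =
      Ideal.Quotient.mk _ (X 1) := fun c =>
    Ideal.Quotient.eq.mpr (Ideal.mem_span_singleton.mpr ⟨C c, by rw [pencilLine]; ring⟩)
  simp only [h, Finset.prod_const, hcard]

namespace IsPencilQuotient

variable {S T : Finset k} {P : MvPolynomial (Fin 3) k}

theorem notMem_left (h : IsPencilQuotient S T P) {c : k} (hc : c ∈ T) : c ∉ S := fun hS =>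
  Finset.disjoint_left.mp h.disjoint hS hc

theorem notMem_right (h : IsPencilQuotient S T P) {c : k} (hc : c ∈ S) : c ∉ T := fun hT =>
  Finset.disjoint_left.mp h.disjoint hc hT

theorem eval_mul_eq (h : IsPencilQuotient S T P) (v : Fin 3 → k) :
    (v 2 - 2 * v 0) * eval v P = eval v (pencilProd T) - eval v (pencilProd S) := by
  simpa using congrArg (eval v) h.mul_eq

theorem eval_rationalCurve_middle (h : IsPencilQuotient S T P) (c : k) :
    eval ![1, c, 1] (rationalCurve T P) = eval ![1, c, 1] (pencilProd S) := by
  have h1 := h.eval_mul_eq ![1, c, 1]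
  simp only [Matrix.cons_val] at h1
  simp only [rationalCurve, map_add, map_mul, eval_X, Matrix.cons_val]
  linear_combination -h1

variable [CharZero k]

/-- On a line of the pencil with parameter in `S` or `T`, `P` vanishes at `[1 : 0 : 2]` only. -/
theorem eval_ne_zero (h : IsPencilQuotient S T P) {c : k} (hc : c ∈ S ∨ c ∈ T) :
    eval ![1, 2 * c, 0] P ≠ 0 := by
  have hline : (![1, 2 * c, 0] : Fin 3 → k) 1 +
      c * (![1, 2 * c, 0] 2 - 2 * ![1, 2 * c, 0] 0) = 0 := by
    simp
    ring
  have hr : (![1, 2 * c, 0] : Fin 3 → k) 2 - 2 * ![1, 2 * c, 0] 0 ≠ 0 := by simp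
  have h1 := h.eval_mul_eq ![1, 2 * c, 0]
  intro h0
  rw [h0, mul_zero] at h1
  rcases hc with hc | hc
  · rw [eval_pencilProd_eq_zero hc hline, sub_zero] at h1
    exact eval_pencilProd_ne_zero (h.notMem_right hc) hline hr h1.symm
  · rw [eval_pencilProd_eq_zero hc hline, zero_sub, zero_eq_neg] at h1
    exact eval_pencilProd_ne_zero (h.notMem_left hc) hline hr h1

theorem ne_zero (h : IsPencilQuotient S T P) : P ≠ 0 := by
  rintro rfl
  obtain ⟨c, hc⟩ := h.nonempty
  exact h.eval_ne_zero (Or.inl hc) (map_zero _)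

theorem isHomogeneous (h : IsPencilQuotient S T P) {n : ℕ} (hn : S.card = n + 1) :
    P.IsHomogeneous n := by
  have h1 : (horizontalLine 2 * P).IsHomogeneous S.card := by
    rw [h.mul_eq]
    exact (h.card_eq ▸ pencilProd_isHomogeneous T).sub (pencilProd_isHomogeneous S)
  obtain ⟨m, hm, hP⟩ := isHomogeneous_of_mul_left (horizontalLine_isHomogeneous (2 : k))
    (horizontalLine_ne_zero 2) h.ne_zero h1
  rwa [show n = m by omega]

theorem isHomogeneous_rationalCurve (h : IsPencilQuotient S T P) :
    (rationalCurve T P).IsHomogeneous S.card := by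
  obtain ⟨n, hn⟩ := Nat.exists_eq_add_one.mpr h.nonempty.card_pos
  have h1 := (isHomogeneous_X k 2).mul (h.isHomogeneous hn)
  rw [add_comm, ← hn] at h1
  exact h1.add (h.card_eq ▸ pencilProd_isHomogeneous T)

/-- The curve passes through `[1 : 2 c : 0]` for no parameter `c` in `S`. -/
theorem eval_rationalCurve_bottom_ne_zero (h : IsPencilQuotient S T P) {c : k} (hc : c ∈ S) :
    eval ![1, 2 * c, 0] (rationalCurve T P) ≠ 0 := by
  have := eval_pencilProd_ne_zero (v := ![1, 2 * c, 0]) (h.notMem_right hc)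
    (by simp; ring) (by simp)
  simpa [rationalCurve] using this

theorem rationalCurve_ne_zero (h : IsPencilQuotient S T P) : rationalCurve T P ≠ 0 := by
  obtain ⟨c, hc⟩ := h.nonempty
  exact fun h0 => h.eval_rationalCurve_bottom_ne_zero hc (by rw [h0, map_zero])

theorem not_horizontalLine_zero_dvd (h : IsPencilQuotient S T P) :
    ¬ horizontalLine 0 ∣ rationalCurve T P := by
  obtain ⟨c, hc⟩ := h.nonempty
  exact not_dvd_of_eval_ne_zero ![1, 2 * c, 0] (by simp) (h.eval_rationalCurve_bottom_ne_zero hc)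

theorem not_pencilLine_dvd (h : IsPencilQuotient S T P) {c : k} (hc : c ∈ S) :
    ¬ pencilLine c ∣ rationalCurve T P :=
  not_dvd_of_eval_ne_zero ![1, 2 * c, 0] (by simp; ring) (h.eval_rationalCurve_bottom_ne_zero hc)

theorem not_horizontalLine_one_dvd (h : IsPencilQuotient S T P) :
    ¬ horizontalLine 1 ∣ rationalCurve T P := by
  obtain ⟨c, hc⟩ : T.Nonempty := by
    rw [← Finset.card_pos, ← h.card_eq]
    exact h.nonempty.card_pos
  refine not_dvd_of_eval_ne_zero ![1, c, 1] (by simp) ?_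
  rw [h.eval_rationalCurve_middle]
  exact eval_pencilProd_ne_zero (h.notMem_left hc) (by simp; ring) (by simp; norm_num)

theorem one_le_mult_middle (h : IsPencilQuotient S T P) {c : k} (hc : c ∈ S) :
    1 ≤ mult (c, 1) (rationalCurve T P) := by
  refine one_le_mult h.rationalCurve_ne_zero h.isHomogeneous_rationalCurve ?_
  rw [h.eval_rationalCurve_middle]
  exact eval_pencilProd_eq_zero hc (by simp; ring)

theorem one_le_mult_bottom (h : IsPencilQuotient S T P) {c : k} (hc : c ∈ T) :
    1 ≤ mult (2 * c, 0) (rationalCurve T P) := by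
  refine one_le_mult h.rationalCurve_ne_zero h.isHomogeneous_rationalCurve ?_
  have := eval_pencilProd_eq_zero (v := ![1, 2 * c, 0]) hc (by simp; ring)
  simpa [rationalCurve] using this

theorem le_mult_top (h : IsPencilQuotient S T P) {n : ℕ} (hn : S.card = n + 1) :
    n ≤ mult (0, 2) (rationalCurve T P) := by
  -- `(x₂ - 2 x₀) f = 2 (x₂ - x₀) ∏_T - x₂ ∏_S` has multiplicity at least `n + 1`
  have h1 : horizontalLine 2 * rationalCurve T P =
      C 2 * horizontalLine 1 * pencilProd T - X 2 * pencilProd S := by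
    rw [rationalCurve, mul_add, mul_left_comm, h.mul_eq]
    simp only [horizontalLine, map_one, map_ofNat]
    ring
  have hmem : ∀ U : Finset k, U.card = n + 1 →
      pencilProd U ∈ pointIdeal ((0 : k), (2 : k)) ^ (n + 1) :=
    fun U hU => mem_pointIdeal_pow_of_le_mult (hU ▸ card_le_mult_pencilProd U)
  have hf0 := h.rationalCurve_ne_zero
  have h2 : n + 1 ≤ mult (0, 2) (horizontalLine 2 * rationalCurve T P) := by
    rw [le_mult_iff_X_pow_dvd (mul_ne_zero (horizontalLine_ne_zero 2) hf0)]
    apply X_pow_dvd_contraction_of_mem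
    rw [h1]
    exact Ideal.sub_mem _ (Ideal.mul_mem_left _ _ (hmem T (h.card_eq ▸ hn)))
      (Ideal.mul_mem_left _ _ (hmem S hn))
  rw [mult_mul _ (horizontalLine_ne_zero 2) hf0] at h2
  have h3 := mult_line_le_one (horizontalLine_isHomogeneous (2 : k)) (0, 2)
  omega

theorem isRelPrime_pencilLine (h : IsPencilQuotient S T P) {c : k} (hc : c ∈ S ∨ c ∈ T) :
    IsRelPrime (pencilLine c) P :=
  isRelPrime_of_eval_ne_zero (pencilLine_isHomogeneous c) (pencilLine_ne_zero c) ![1, 2 * c, 0]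
    (by simp; ring) (h.eval_ne_zero hc)

theorem isRelPrime_rationalCurve (h : IsPencilQuotient S T P) :
    IsRelPrime (rationalCurve T P) P := by
  intro q hq1 hq2
  have h1 : IsRelPrime (pencilProd T) P :=
    IsRelPrime.prod_left fun c hc => h.isRelPrime_pencilLine (Or.inr hc)
  exact h1 ((dvd_add_right (dvd_mul_of_dvd_right hq2 (X 2))).mp hq1) hq2

/-- Bézout's inequality for the rational curve, which is parametrised by the lines of the pencil:
the parameters `c ∈ S` and `c ∈ T` give the points `[1 : c : 1]` and `[1 : 2 c : 0]`, and the
zeros of `P` give `[1 : 0 : 2]`. -/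
theorem bezout_rationalCurve (h : IsPencilQuotient S T P) {n : ℕ} (hn : S.card = n + 1)
    {F : MvPolynomial (Fin 3) k} {d : ℕ} (hF : F.IsHomogeneous d)
    (hndvd : ¬ rationalCurve T P ∣ F) :
    n * mult (0, 2) F + ∑ c ∈ S, mult (c, 1) F + ∑ c ∈ T, mult (2 * c, 0) F ≤ (n + 1) * d := by
  classical
  have hF0 : F ≠ 0 := by
    rintro rfl
    exact hndvd (dvd_zero _)
  have hPh := h.isHomogeneous hn
  have hT : (pencilProd T).IsHomogeneous (n + 1) := by
    have := pencilProd_isHomogeneous T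
    rwa [← h.card_eq, hn] at this
  have hdvdS : ∀ c ∈ S, pencilLine c ∣ pencilProd S := fun c hc => Finset.dvd_prod_of_mem _ hc
  have hdvdT : ∀ c ∈ T, pencilLine c ∣ pencilProd T := fun c hc => Finset.dvd_prod_of_mem _ hc
  have hmul := h.mul_eq
  let g : Fin 3 → MvPolynomial (Fin 3) k :=
    ![- horizontalLine 2 * P - pencilProd T, 2 * X 1 * P, - 2 * pencilProd T]
  have hg0 : g 0 = - horizontalLine 2 * P - pencilProd T := rfl
  have hg1 : g 1 = 2 * X 1 * P := rfl
  have hg2 : g 2 = - 2 * pencilProd T := rfl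
  have hrel : ∀ c c' : k, c ≠ c' → IsRelPrime (pencilLine c) (pencilLine c') := by
    intro c c' hcc'
    refine isRelPrime_of_eval_ne_zero (pencilLine_isHomogeneous c) (pencilLine_ne_zero c)
      ![1, 2 * c, 0] (by simp; ring) ?_
    have : 2 * (c - c') ≠ 0 := mul_ne_zero two_ne_zero (sub_ne_zero.mpr hcc')
    simp only [eval_pencilLine, Matrix.cons_val]
    intro h0
    exact this (by linear_combination h0)
  let DA := P ^ mult (0, 2) F
  let DS := ∏ c ∈ S, pencilLine c ^ mult (c, 1) F
  let DT := ∏ c ∈ T, pencilLine c ^ mult (2 * c, 0) F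
  have hA : DA ∣ aeval g F := by
    refine pow_dvd_aeval_of_le_mult hF0 le_rfl ?_ ?_
    · exact ⟨2 * X 1, by rw [hg1]; simp; ring⟩
    · exact ⟨2 * horizontalLine 2, by rw [hg2, hg0]; simp only [map_ofNat]; ring⟩
  have hS : DS ∣ aeval g F := by
    refine Finset.prod_dvd_of_isRelPrime (fun c _ c' _ hcc' => (hrel c c' hcc').pow) fun c hc => ?_
    obtain ⟨q, hq⟩ := hdvdS c hc
    refine pow_dvd_aeval_of_le_mult hF0 le_rfl ?_ ?_
    · refine ⟨2 * P + C c * q, ?_⟩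
      rw [hg1, hg0]
      simp only [pencilLine] at hq ⊢
      linear_combination (-C c) * hmul + C c * hq
    · refine ⟨- q, ?_⟩
      rw [hg2, hg0, mul_neg, ← hq, map_one]
      linear_combination hmul
  have hTd : DT ∣ aeval g F := by
    refine Finset.prod_dvd_of_isRelPrime (fun c _ c' _ hcc' => (hrel c c' hcc').pow) fun c hc => ?_
    obtain ⟨q, hq⟩ := hdvdT c hc
    refine pow_dvd_aeval_of_le_mult hF0 le_rfl ?_ ?_
    · refine ⟨2 * P + 2 * C c * q, ?_⟩
      rw [hg1, hg0]
      simp only [pencilLine, map_mul, map_ofNat] at hq ⊢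
      linear_combination 2 * C c * hq
    · refine ⟨- 2 * q, ?_⟩
      rw [hg2, hg0, mul_left_comm, ← hq, map_zero]
      ring
  have hAST : DA * DS * DT ∣ aeval g F := by
    refine IsRelPrime.mul_dvd (IsRelPrime.mul_left ?_ ?_) (IsRelPrime.mul_dvd ?_ hA hS) hTd
    · exact IsRelPrime.prod_right fun c hc =>
        (h.isRelPrime_pencilLine (Or.inr hc)).symm.pow
    · refine IsRelPrime.prod_left fun c hc => IsRelPrime.prod_right fun c' hc' => ?_
      exact (hrel c c' fun hcc => h.notMem_right hc (hcc ▸ hc')).pow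
    · exact IsRelPrime.prod_right fun c hc =>
        (h.isRelPrime_pencilLine (Or.inl hc)).symm.pow
  have hrelP : IsRelPrime (rationalCurve T P) (2 * P) := by
    refine IsRelPrime.mul_right (IsUnit.isRelPrime_right ?_) h.isRelPrime_rationalCurve
    rw [← map_ofNat C 2]
    exact (isUnit_iff_ne_zero.mpr (two_ne_zero (α := k))).map C
  have key := totalDegree_le_of_dvd_aeval (g := g) (e := n + 1) hrelP ?_ hF ?_ hndvd hAST
  · have hS0 : DS ≠ 0 := Finset.prod_ne_zero_iff.mpr fun c _ => pow_ne_zero _ (pencilLine_ne_zero c)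
    have hT0 : DT ≠ 0 := Finset.prod_ne_zero_iff.mpr fun c _ => pow_ne_zero _ (pencilLine_ne_zero c)
    have hA0 : DA ≠ 0 := pow_ne_zero _ h.ne_zero
    rw [totalDegree_mul_of_isDomain (mul_ne_zero hA0 hS0) hT0, totalDegree_mul_of_isDomain hA0 hS0,
      totalDegree_pow_of_isHomogeneous hPh h.ne_zero,
      totalDegree_prod_pow S pencilLine_isHomogeneous pencilLine_ne_zero,
      totalDegree_prod_pow T pencilLine_isHomogeneous pencilLine_ne_zero]
      at key
    exact key
  · intro i
    fin_cases i
    · refine ⟨1, ?_⟩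
      change 2 * P * X 0 - (- horizontalLine 2 * P - pencilProd T) = _
      simp only [rationalCurve, horizontalLine, map_ofNat]
      ring
    · refine ⟨0, ?_⟩
      change 2 * P * X 1 - 2 * X 1 * P = _
      ring
    · refine ⟨2, ?_⟩
      change 2 * P * X 2 - - 2 * pencilProd T = _
      simp only [rationalCurve]
      ring
  · intro i
    have h2 : ((2 : MvPolynomial (Fin 3) k)).IsHomogeneous 0 := by
      rw [← map_ofNat C 2]
      exact isHomogeneous_C (Fin 3) (2 : k)
    fin_cases i
    · have := ((horizontalLine_isHomogeneous (2 : k)).neg.mul hPh)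
      rw [add_comm] at this
      exact this.sub hT
    · have := ((h2.mul (isHomogeneous_X k 1)).mul hPh)
      rwa [zero_add, add_comm] at this
    · have := h2.neg.mul hT
      rwa [zero_add] at this

end IsPencilQuotient

end RationalCurve

/-! ### The negative curves of the configuration -/

section Configuration

variable {k : Type*} [Field k]

/-- The sum of the multiplicities at the points `[1 : j : 1]`, `j ≤ n`. -/
noncomputable def middleMult (n : ℕ) (F : MvPolynomial (Fin 3) k) : ℕ :=
  ∑ j ∈ Finset.range (n + 1), mult ((j : k), 1) F

/-- The sum of the multiplicities at the points `[1 : 2 j : 0]`, `j ≤ n`. -/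
noncomputable def evenMult (n : ℕ) (F : MvPolynomial (Fin 3) k) : ℕ :=
  ∑ j ∈ Finset.range (n + 1), mult (2 * (j : k), 0) F

/-- The sum of the multiplicities at the points `[1 : 2 j + 1 : 0]`, `j ≤ n`. -/
noncomputable def oddMult (n : ℕ) (F : MvPolynomial (Fin 3) k) : ℕ :=
  ∑ j ∈ Finset.range (n + 1), mult (2 * (j : k) + 1, 0) F

/-- The sum of the multiplicities of a curve at the points of the configuration with weights
`2 e² (e - 1)` at `[1 : 0 : 2]`, `2 e (e - 1)` at `[1 : j : 1]` for `j < e`, `e (2 e - 1)` at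
`[1 : e : 1]`, `e` at `[1 : 2 j : 0]` and `(2 e + 1) (e - 1)` at `[1 : 2 j + 1 : 0]`, where
`e = n + 1`. -/
noncomputable def weightedMult (n : ℕ) (F : MvPolynomial (Fin 3) k) : ℕ :=
  2 * (n + 1) ^ 2 * n * mult (0, 2) F + 2 * (n + 1) * n * middleMult n F +
    (n + 1) * (2 * n + 1) * mult ((n : k) + 1, 1) F + (n + 1) * evenMult n F +
    (2 * n + 3) * n * oddMult n F

theorem weightedMult_mul (n : ℕ) {F G : MvPolynomial (Fin 3) k} (hF : F ≠ 0) (hG : G ≠ 0) :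
    weightedMult n (F * G) = weightedMult n F + weightedMult n G := by
  simp only [weightedMult, middleMult, evenMult, oddMult, mult_mul _ hF hG, Finset.sum_add_distrib]
  ring

theorem sum_range_even_odd (f : ℕ → ℕ) (n : ℕ) : ∑ j ∈ Finset.range (2 * n), f j =
    ∑ j ∈ Finset.range n, f (2 * j) + ∑ j ∈ Finset.range n, f (2 * j + 1) := by
  induction n with
  | zero => simp
  | succ n ih =>
    rw [Nat.mul_succ, Finset.sum_range_succ, Finset.sum_range_succ, ih, Finset.sum_range_succ,
      Finset.sum_range_succ]
    omega

variable [CharZero k]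

/-- The embedding `j ↦ j + 1/2` of the natural numbers in a field of characteristic zero. -/
noncomputable def halfEmbedding (k : Type*) [Field k] [CharZero k] : ℕ ↪ k where
  toFun j := (j : k) + 1 / 2
  inj' i j h := by simpa using h

/-- The parameters of the lines joining `[1 : 0 : 2]` to the points `[1 : j : 1]`, `j ≤ n + 1`,
`j ≠ i`. -/
noncomputable def middleParams (k : Type*) [Field k] [CharZero k] (n i : ℕ) : Finset k :=
  ((Finset.range (n + 2)).erase i).map Nat.castEmbedding

/-- The parameters of the lines joining `[1 : 0 : 2]` to the points `[1 : 2 j + 1 : 0]`,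
`j ≤ n`. -/
noncomputable def oddParams (k : Type*) [Field k] [CharZero k] (n : ℕ) : Finset k :=
  (Finset.range (n + 1)).map (halfEmbedding k)

theorem card_middleParams {n i : ℕ} (hi : i < n + 1) : (middleParams k n i).card = n + 1 := by
  rw [middleParams, Finset.card_map, Finset.card_erase_of_mem (Finset.mem_range.mpr (by omega)),
    Finset.card_range]
  rfl

theorem natCast_ne_natCast_add_half (i j : ℕ) : (i : k) ≠ (j : k) + 1 / 2 := by
  intro h
  have h1 : ((2 * i : ℕ) : k) = ((2 * j + 1 : ℕ) : k) := by
    push_cast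
    rw [h]
    ring
  have h2 : 2 * i = 2 * j + 1 := by exact_mod_cast h1
  omega

theorem exists_isPencilQuotient_params (k : Type*) [Field k] [CharZero k] {n i : ℕ}
    (hi : i < n + 1) : ∃ P, IsPencilQuotient (middleParams k n i) (oddParams k n) P := by
  refine exists_isPencilQuotient ?_ ?_ ?_
  · rw [Finset.disjoint_left]
    intro c h1 h2
    obtain ⟨a, -, rfl⟩ := Finset.mem_map.mp h1
    obtain ⟨c, -, hc⟩ := Finset.mem_map.mp h2
    exact natCast_ne_natCast_add_half (k := k) a c hc.symm
  · rw [card_middleParams hi, oddParams, Finset.card_map, Finset.card_range]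
  · rw [← Finset.card_pos, card_middleParams hi]
    exact Nat.succ_pos n

theorem bezout_bottom (n : ℕ) {F : MvPolynomial (Fin 3) k} {d : ℕ} (hF : F.IsHomogeneous d)
    (hndvd : ¬ horizontalLine 0 ∣ F) : evenMult n F + oddMult n F ≤ d := by
  have h := bezout_horizontalLine 0 hF hndvd ((Finset.range (2 * (n + 1))).map Nat.castEmbedding)
  rw [Finset.sum_map, sum_range_even_odd] at h
  simpa [evenMult, oddMult] using h

theorem bezout_middle (n : ℕ) {F : MvPolynomial (Fin 3) k} {d : ℕ} (hF : F.IsHomogeneous d)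
    (hndvd : ¬ horizontalLine 1 ∣ F) : middleMult n F + mult ((n : k) + 1, 1) F ≤ d := by
  have h := bezout_horizontalLine 1 hF hndvd ((Finset.range (n + 2)).map Nat.castEmbedding)
  rw [Finset.sum_map, Finset.sum_range_succ] at h
  simpa [middleMult] using h

theorem sum_middleParams {n i : ℕ} (hi : i < n + 1) (F : MvPolynomial (Fin 3) k) :
    ∑ c ∈ middleParams k n i, mult (c, 1) F + mult ((i : k), 1) F =
      middleMult n F + mult ((n : k) + 1, 1) F := by
  rw [middleParams, Finset.sum_map]
  have := Finset.sum_erase_add (Finset.range (n + 2)) (fun j : ℕ => mult ((j : k), 1) F)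
    (Finset.mem_range.mpr (show i < n + 2 by omega))
  rw [Finset.sum_range_succ] at this
  simpa [middleMult] using this

theorem sum_oddParams (n : ℕ) (F : MvPolynomial (Fin 3) k) :
    ∑ c ∈ oddParams k n, mult (2 * c, 0) F = oddMult n F := by
  rw [oddParams, Finset.sum_map, oddMult]
  refine Finset.sum_congr rfl fun j _ => ?_
  congr 2
  simp [halfEmbedding, mul_add]

theorem weightedMult_bottomLine (n : ℕ) :
    weightedMult n (horizontalLine (0 : k)) ≤ (n + 1) * (2 * n ^ 2 + 4 * n + 1) := by
  have ha : mult (0, 2) (horizontalLine (0 : k)) = 0 := mult_eq_zero_of_eval_ne_zero (by simp)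
  have hB : ∀ x : k, mult (x, 1) (horizontalLine (0 : k)) = 0 := fun x =>
    mult_eq_zero_of_eval_ne_zero (by simp)
  have hE : evenMult n (horizontalLine (0 : k)) ≤ n + 1 := by
    simpa [evenMult] using Finset.sum_le_card_nsmul (Finset.range (n + 1)) _ 1 fun j _ =>
      mult_line_le_one (horizontalLine_isHomogeneous (0 : k)) (2 * (j : k), 0)
  have hO : oddMult n (horizontalLine (0 : k)) ≤ n + 1 := by
    simpa [oddMult] using Finset.sum_le_card_nsmul (Finset.range (n + 1)) _ 1 fun j _ =>
      mult_line_le_one (horizontalLine_isHomogeneous (0 : k)) (2 * (j : k) + 1, 0)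
  simp only [weightedMult, middleMult, ha, hB, Finset.sum_const_zero]
  have h1 := Nat.mul_le_mul_left (n + 1) hE
  have h2 := Nat.mul_le_mul_left ((2 * n + 3) * n) hO
  linarith

theorem weightedMult_middleLine (n : ℕ) :
    weightedMult n (horizontalLine (1 : k)) ≤ (n + 1) * (2 * n ^ 2 + 4 * n + 1) := by
  have ha : mult (0, 2) (horizontalLine (1 : k)) = 0 :=
    mult_eq_zero_of_eval_ne_zero (by simp; norm_num)
  have hC : ∀ x : k, mult (x, 0) (horizontalLine (1 : k)) = 0 := fun x =>
    mult_eq_zero_of_eval_ne_zero (by simp)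
  have hB : middleMult n (horizontalLine (1 : k)) ≤ n + 1 := by
    simpa [middleMult] using Finset.sum_le_card_nsmul (Finset.range (n + 1)) _ 1 fun j _ =>
      mult_line_le_one (horizontalLine_isHomogeneous (1 : k)) ((j : k), 1)
  have hb := mult_line_le_one (horizontalLine_isHomogeneous (1 : k)) ((n : k) + 1, 1)
  simp only [weightedMult, evenMult, oddMult, ha, hC, Finset.sum_const_zero]
  have h1 := Nat.mul_le_mul_left (2 * (n + 1) * n) hB
  have h2 := Nat.mul_le_mul_left ((n + 1) * (2 * n + 1)) hb
  linarith

theorem weightedMult_pencilLine {n j : ℕ} (hj : j < n + 1) :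
    weightedMult n (pencilLine (j : k)) ≤ (n + 1) * (2 * n ^ 2 + 4 * n + 1) := by
  have hl := pencilLine_isHomogeneous (j : k)
  have ha := mult_line_le_one hl ((0 : k), 2)
  have hb : mult ((n : k) + 1, 1) (pencilLine (j : k)) = 0 :=
    mult_middle_pencilLine_eq_zero (by
      have : n + 1 ≠ j := by omega
      exact_mod_cast this)
  have hO : oddMult n (pencilLine (j : k)) = 0 := Finset.sum_eq_zero fun i _ =>
    mult_bottom_pencilLine_eq_zero (by
      have : 2 * i + 1 ≠ 2 * j := by omega
      exact_mod_cast this)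
  have hB := bezout_middle n hl
    (not_dvd_of_eval_ne_zero ![1, (j : k) + 1, 1] (by simp) (by simp; ring_nf; simp))
  have hE := bezout_bottom n hl
    (not_dvd_of_eval_ne_zero ![1, 2 * (j : k) + 1, 0] (by simp) (by simp; ring_nf; simp))
  rw [hb, add_zero] at hB
  rw [hO, add_zero] at hE
  simp only [weightedMult, hb, hO]
  have h1 := Nat.mul_le_mul_left (2 * (n + 1) ^ 2 * n) ha
  have h2 := Nat.mul_le_mul_left (2 * (n + 1) * n) hB
  have h3 := Nat.mul_le_mul_left (n + 1) hE
  linarith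

theorem weightedMult_lastPencilLine (n : ℕ) :
    weightedMult n (pencilLine ((n : k) + 1)) ≤ (n + 1) * (2 * n ^ 2 + 4 * n + 1) := by
  have hl := pencilLine_isHomogeneous ((n : k) + 1)
  have ha := mult_line_le_one hl ((0 : k), 2)
  have hb := mult_line_le_one hl ((n : k) + 1, 1)
  have hB : middleMult n (pencilLine ((n : k) + 1)) = 0 := Finset.sum_eq_zero fun i hi =>
    mult_middle_pencilLine_eq_zero (by
      have : i ≠ n + 1 := (Finset.mem_range.mp hi).ne
      exact_mod_cast this)
  have hE : evenMult n (pencilLine ((n : k) + 1)) = 0 := Finset.sum_eq_zero fun i hi =>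
    mult_bottom_pencilLine_eq_zero (by
      have : 2 * i ≠ 2 * (n + 1) := by have := Finset.mem_range.mp hi; omega
      exact_mod_cast this)
  have hO : oddMult n (pencilLine ((n : k) + 1)) = 0 := Finset.sum_eq_zero fun i _ =>
    mult_bottom_pencilLine_eq_zero (by
      have : 2 * i + 1 ≠ 2 * (n + 1) := by omega
      exact_mod_cast this)
  simp only [weightedMult, hB, hE, hO]
  have h1 := Nat.mul_le_mul_left (2 * (n + 1) ^ 2 * n) ha
  have h2 := Nat.mul_le_mul_left ((n + 1) * (2 * n + 1)) hb
  linarith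

/-- The multiplicities of the rational curve are bounded by Bézout's inequality on the two
horizontal lines and on the last line of the pencil. -/
theorem weightedMult_rationalCurve {n i : ℕ} (hi : i < n + 1) {P : MvPolynomial (Fin 3) k}
    (hP : IsPencilQuotient (middleParams k n i) (oddParams k n) P) :
    weightedMult n (rationalCurve (oddParams k n) P) ≤
      (n + 1) * (2 * n ^ 2 + 4 * n + 1) * (n + 1) := by
  have hcard := card_middleParams (k := k) hi
  have hf := hP.isHomogeneous_rationalCurve
  rw [hcard] at hf
  have hlast : (n : k) + 1 ∈ middleParams k n i :=
    Finset.mem_map.mpr ⟨n + 1, Finset.mem_erase.mpr ⟨by omega, by simp⟩, by simp⟩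
  have hB := bezout_middle n hf hP.not_horizontalLine_one_dvd
  have hC := bezout_bottom n hf hP.not_horizontalLine_zero_dvd
  have hN := bezout_pencilLine _ hf (hP.not_pencilLine_dvd hlast)
  have hb := hP.one_le_mult_middle hlast
  have hBge : n + 1 ≤ ∑ c ∈ middleParams k n i, mult (c, 1) (rationalCurve (oddParams k n) P) := by
    simpa [hcard] using Finset.card_nsmul_le_sum (middleParams k n i) _ 1 fun c hc =>
      hP.one_le_mult_middle hc
  have hOge : n + 1 ≤ oddMult n (rationalCurve (oddParams k n) P) := by
    rw [← sum_oddParams]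
    simpa [hcard, ← hP.card_eq] using Finset.card_nsmul_le_sum (oddParams k n) _ 1 fun c hc =>
      hP.one_le_mult_bottom hc
  have hBsum : n ≤ middleMult n (rationalCurve (oddParams k n) P) := by
    have hsub : ((Finset.range (n + 1)).erase i).card • 1 ≤
        ∑ j ∈ (Finset.range (n + 1)).erase i, mult ((j : k), 1) (rationalCurve (oddParams k n) P) :=
      Finset.card_nsmul_le_sum _ _ 1 fun j hj => hP.one_le_mult_middle
        (Finset.mem_map.mpr ⟨j, by simp at hj ⊢; omega, rfl⟩)
    rw [Finset.card_erase_of_mem (Finset.mem_range.mpr hi), Finset.card_range] at hsub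
    refine le_trans (by simpa using hsub) (Finset.sum_le_sum_of_subset (Finset.erase_subset _ _))
  have hbe : mult ((n : k) + 1, 1) (rationalCurve (oddParams k n) P) = 1 := by omega
  have hBe : middleMult n (rationalCurve (oddParams k n) P) ≤ n := by omega
  have hE : evenMult n (rationalCurve (oddParams k n) P) = 0 := by omega
  have hO : oddMult n (rationalCurve (oddParams k n) P) ≤ n + 1 := by omega
  have ha : mult (0, 2) (rationalCurve (oddParams k n) P) ≤ n := by omega
  simp only [weightedMult, hbe, hE]
  have h1 := Nat.mul_le_mul_left (2 * (n + 1) ^ 2 * n) ha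
  have h2 := Nat.mul_le_mul_left (2 * (n + 1) * n) hBe
  have h3 := Nat.mul_le_mul_left ((2 * n + 3) * n) hO
  linarith

/-- If none of the negative curves divides `F`, the bound is a nonnegative combination of Bézout's
inequalities.  With `e = n + 1` and `K = 2 e² - 2 e - 1`, the multiple by `2 e - 1` of
`deg ≥ weightedMult` is `e + 1` times the inequality for `x₂ = 0`, plus `2 e - 1` times that for
`x₂ = x₀`, plus `K` times those for the lines of the pencil with parameters `j < e`, plus
`e (2 e - 1)` times that for the parameter `e`, plus `2 K` times those for the rational curves. -/
theorem weightedMult_le_of_not_dvd {n : ℕ} (hn : 1 ≤ n) {P : ℕ → MvPolynomial (Fin 3) k}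
    (hP : ∀ i < n + 1, IsPencilQuotient (middleParams k n i) (oddParams k n) (P i))
    {F : MvPolynomial (Fin 3) k} {d : ℕ} (hF : F.IsHomogeneous d)
    (h0 : ¬ horizontalLine 0 ∣ F) (h1 : ¬ horizontalLine 1 ∣ F)
    (hM : ∀ j < n + 1, ¬ pencilLine (j : k) ∣ F) (hN : ¬ pencilLine ((n : k) + 1) ∣ F)
    (hD : ∀ i < n + 1, ¬ rationalCurve (oddParams k n) (P i) ∣ F) :
    weightedMult n F ≤ (n + 1) * (2 * n ^ 2 + 4 * n + 1) * d := by
  have e0 := bezout_bottom n hF h0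
  have e1 := bezout_middle n hF h1
  have eN := bezout_pencilLine _ hF hN
  have eM : (n + 1) * mult (0, 2) F + middleMult n F + evenMult n F ≤ (n + 1) * d := by
    have := Finset.sum_le_sum fun j hj => bezout_pencilLine _ hF (hM j (Finset.mem_range.mp hj))
    simpa [Finset.sum_add_distrib, middleMult, evenMult] using this
  have eD : (n + 1) * (n * mult (0, 2) F + middleMult n F + mult ((n : k) + 1, 1) F +
      oddMult n F) ≤ (n + 1) * ((n + 1) * d) + middleMult n F := by
    have h : ∀ i ∈ Finset.range (n + 1), n * mult (0, 2) F + middleMult n F +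
        mult ((n : k) + 1, 1) F + oddMult n F ≤ (n + 1) * d + mult ((i : k), 1) F := by
      intro i hi
      have hi := Finset.mem_range.mp hi
      have h2 := (hP i hi).bezout_rationalCurve (card_middleParams hi) hF (hD i hi)
      have h3 := sum_middleParams hi F
      rw [sum_oddParams] at h2
      omega
    have := Finset.sum_le_sum h
    simpa [Finset.sum_add_distrib, middleMult] using this
  have ea : mult (0, 2) F + mult ((n : k) + 1, 1) F ≤ d := by omega
  unfold weightedMult
  generalize mult (0, 2) F = a at *
  generalize middleMult n F = B at *
  generalize mult ((n : k) + 1, 1) F = b at *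
  generalize evenMult n F = E at *
  generalize oddMult n F = O at *
  clear eN
  zify at *
  have hK : (0 : ℤ) ≤ 2 * n ^ 2 + 2 * n - 1 := by nlinarith
  have hpos : (0 : ℤ) < 2 * n + 1 := by linarith
  refine le_of_mul_le_mul_left ?_ hpos
  have t0 := mul_le_mul_of_nonneg_left e0 (by linarith : (0 : ℤ) ≤ n + 2)
  have t1 := mul_le_mul_of_nonneg_left e1 hpos.le
  have tM := mul_le_mul_of_nonneg_left eM hK
  have tN := mul_le_mul_of_nonneg_left ea (mul_nonneg (by linarith : (0 : ℤ) ≤ n + 1) hpos.le)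
  have tD := mul_le_mul_of_nonneg_left eD (mul_nonneg zero_le_two hK)
  have tb := mul_nonneg hK (Int.natCast_nonneg b)
  linarith

/-- The weights define a nef class. -/
theorem weightedMult_le {n : ℕ} (hn : 1 ≤ n) {P : ℕ → MvPolynomial (Fin 3) k}
    (hP : ∀ i < n + 1, IsPencilQuotient (middleParams k n i) (oddParams k n) (P i)) (d : ℕ) :
    ∀ F : MvPolynomial (Fin 3) k, F ≠ 0 → F.IsHomogeneous d →
      weightedMult n F ≤ (n + 1) * (2 * n ^ 2 + 4 * n + 1) * d := by
  induction d using Nat.strong_induction_on with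
  | _ d ih =>
  intro F hF0 hF
  -- a negative curve that divides `F` can be split off
  have split : ∀ (f : MvPolynomial (Fin 3) k) (e : ℕ), 0 < e → f.IsHomogeneous e →
      weightedMult n f ≤ (n + 1) * (2 * n ^ 2 + 4 * n + 1) * e → f ∣ F →
      weightedMult n F ≤ (n + 1) * (2 * n ^ 2 + 4 * n + 1) * d := by
    rintro f e he hfe hf ⟨G, rfl⟩
    have hf0 := left_ne_zero_of_mul hF0
    have hG0 := right_ne_zero_of_mul hF0
    obtain ⟨m, rfl, hG⟩ := isHomogeneous_of_mul_left hfe hf0 hG0 hF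
    rw [weightedMult_mul n hf0 hG0, mul_add]
    exact add_le_add hf (ih m (by omega) G hG0 hG)
  by_contra hcon
  refine hcon (weightedMult_le_of_not_dvd hn hP hF ?_ ?_ ?_ ?_ ?_)
  · exact fun h => hcon (split _ 1 one_pos (horizontalLine_isHomogeneous 0)
      (by simpa using weightedMult_bottomLine n) h)
  · exact fun h => hcon (split _ 1 one_pos (horizontalLine_isHomogeneous 1)
      (by simpa using weightedMult_middleLine n) h)
  · exact fun j hj h => hcon (split _ 1 one_pos (pencilLine_isHomogeneous _)
      (by simpa using weightedMult_pencilLine hj) h)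
  · exact fun h => hcon (split _ 1 one_pos (pencilLine_isHomogeneous _)
      (by simpa using weightedMult_lastPencilLine n) h)
  · intro i hi h
    have hf := (hP i hi).isHomogeneous_rationalCurve
    rw [card_middleParams hi] at hf
    exact hcon (split _ (n + 1) n.succ_pos hf (weightedMult_rationalCurve hi (hP i hi)) h)

/-! ### The extremal curve -/

/-- The union of the negative curves, with the multiplicities that make its multiplicity at each
point of the configuration at least `2 n² + 4 n + 1`. -/
noncomputable def extremalCurve (n : ℕ) (P : ℕ → MvPolynomial (Fin 3) k) :
    MvPolynomial (Fin 3) k :=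
  horizontalLine 0 ^ ((2 * n + 3) * n) * horizontalLine 1 ^ (2 * (n + 1) * n) *
    (∏ j ∈ Finset.range (n + 1), pencilLine (j : k)) ^ (n + 1) * pencilLine ((n : k) + 1) ^ n *
    ∏ i ∈ Finset.range (n + 1), rationalCurve (oddParams k n) (P i)

variable {n : ℕ} {P : ℕ → MvPolynomial (Fin 3) k}

theorem extremalCurve_ne_zero
    (hP : ∀ i < n + 1, IsPencilQuotient (middleParams k n i) (oddParams k n) (P i)) :
    extremalCurve n P ≠ 0 := by
  refine mul_ne_zero (mul_ne_zero (mul_ne_zero (mul_ne_zero ?_ ?_) ?_) ?_) ?_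
  · exact pow_ne_zero _ (horizontalLine_ne_zero 0)
  · exact pow_ne_zero _ (horizontalLine_ne_zero 1)
  · exact pow_ne_zero _ (Finset.prod_ne_zero_iff.mpr fun j _ => pencilLine_ne_zero _)
  · exact pow_ne_zero _ (pencilLine_ne_zero _)
  · exact Finset.prod_ne_zero_iff.mpr fun i hi =>
      (hP i (Finset.mem_range.mp hi)).rationalCurve_ne_zero

theorem extremalCurve_isHomogeneous
    (hP : ∀ i < n + 1, IsPencilQuotient (middleParams k n i) (oddParams k n) (P i)) :
    (extremalCurve n P).IsHomogeneous (6 * n ^ 2 + 10 * n + 2) := by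
  have h1 := (horizontalLine_isHomogeneous (0 : k)).pow ((2 * n + 3) * n)
  have h2 := (horizontalLine_isHomogeneous (1 : k)).pow (2 * (n + 1) * n)
  have h3 := (IsHomogeneous.prod (Finset.range (n + 1)) (fun j => pencilLine (j : k)) (fun _ => 1)
    fun j _ => pencilLine_isHomogeneous _).pow (n + 1)
  have h4 := (pencilLine_isHomogeneous ((n : k) + 1)).pow n
  have h5 := IsHomogeneous.prod (Finset.range (n + 1))
    (fun i => rationalCurve (oddParams k n) (P i)) (fun _ => n + 1) fun i hi => by
      have hi := Finset.mem_range.mp hi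
      have := (hP i hi).isHomogeneous_rationalCurve
      rwa [card_middleParams hi] at this
  have h := (((h1.mul h2).mul h3).mul h4).mul h5
  refine Eq.subst (motive := fun m => (extremalCurve n P).IsHomogeneous m) ?_ h
  simp only [Finset.sum_const, Finset.card_range, smul_eq_mul]
  ring

theorem mult_extremalCurve
    (hP : ∀ i < n + 1, IsPencilQuotient (middleParams k n i) (oddParams k n) (P i)) (p : k × k) :
    mult p (extremalCurve n P) = (2 * n + 3) * n * mult p (horizontalLine 0) +
      2 * (n + 1) * n * mult p (horizontalLine 1) +
      (n + 1) * ∑ j ∈ Finset.range (n + 1), mult p (pencilLine (j : k)) +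
      n * mult p (pencilLine ((n : k) + 1)) +
      ∑ i ∈ Finset.range (n + 1), mult p (rationalCurve (oddParams k n) (P i)) := by
  have h1 := pow_ne_zero ((2 * n + 3) * n) (horizontalLine_ne_zero (0 : k))
  have h2 := pow_ne_zero (2 * (n + 1) * n) (horizontalLine_ne_zero (1 : k))
  have h3 : ∏ j ∈ Finset.range (n + 1), pencilLine (j : k) ≠ 0 :=
    Finset.prod_ne_zero_iff.mpr fun j _ => pencilLine_ne_zero _
  have h4 := pow_ne_zero n (pencilLine_ne_zero ((n : k) + 1))
  have h5 : ∀ i ∈ Finset.range (n + 1), rationalCurve (oddParams k n) (P i) ≠ 0 := fun i hi =>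
    (hP i (Finset.mem_range.mp hi)).rationalCurve_ne_zero
  have h3' := pow_ne_zero (n + 1) h3
  rw [extremalCurve, mult_mul p (mul_ne_zero (mul_ne_zero (mul_ne_zero h1 h2) h3') h4)
    (Finset.prod_ne_zero_iff.mpr h5), mult_mul p (mul_ne_zero (mul_ne_zero h1 h2) h3') h4,
    mult_mul p (mul_ne_zero h1 h2) h3', mult_mul p h1 h2, mult_pow p (horizontalLine_ne_zero 0),
    mult_pow p (horizontalLine_ne_zero 1), mult_pow p h3, mult_pow p (pencilLine_ne_zero _),
    mult_prod p _ _ h5, mult_prod p _ _ fun j _ => pencilLine_ne_zero _]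

theorem le_mult_extremalCurve_top
    (hP : ∀ i < n + 1, IsPencilQuotient (middleParams k n i) (oddParams k n) (P i)) :
    2 * n ^ 2 + 4 * n + 1 ≤ mult (0, 2) (extremalCurve n P) := by
  have h1 : n + 1 ≤ ∑ j ∈ Finset.range (n + 1), mult (0, 2) (pencilLine (j : k)) := by
    simpa using Finset.card_nsmul_le_sum (Finset.range (n + 1)) _ 1 fun j _ =>
      one_le_mult_pencilLine_top (j : k)
  have h2 : (n + 1) * n ≤
      ∑ i ∈ Finset.range (n + 1), mult (0, 2) (rationalCurve (oddParams k n) (P i)) := by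
    simpa using Finset.card_nsmul_le_sum (Finset.range (n + 1)) _ n fun i hi =>
      (hP i (Finset.mem_range.mp hi)).le_mult_top (card_middleParams (Finset.mem_range.mp hi))
  rw [mult_extremalCurve hP]
  have h3 := Nat.mul_le_mul_left (n + 1) h1
  have h4 := Nat.mul_le_mul_left n (one_le_mult_pencilLine_top ((n : k) + 1))
  linarith [Nat.zero_le ((2 * n + 3) * n * mult (0, 2) (horizontalLine (0 : k))),
    Nat.zero_le (2 * (n + 1) * n * mult (0, 2) (horizontalLine (1 : k)))]

theorem le_mult_extremalCurve_middle
    (hP : ∀ i < n + 1, IsPencilQuotient (middleParams k n i) (oddParams k n) (P i))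
    {j : ℕ} (hj : j < n + 2) : 2 * n ^ 2 + 4 * n + 1 ≤ mult ((j : k), 1) (extremalCurve n P) := by
  have hD : ∀ i ∈ (Finset.range (n + 1)).erase j,
      1 ≤ mult ((j : k), 1) (rationalCurve (oddParams k n) (P i)) := by
    intro i hi
    obtain ⟨hij, hi⟩ := Finset.mem_erase.mp hi
    exact (hP i (Finset.mem_range.mp hi)).one_le_mult_middle
      (Finset.mem_map.mpr ⟨j, Finset.mem_erase.mpr ⟨hij.symm, Finset.mem_range.mpr hj⟩, rfl⟩)
  have h2 : ((Finset.range (n + 1)).erase j).card ≤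
      ∑ i ∈ Finset.range (n + 1), mult ((j : k), 1) (rationalCurve (oddParams k n) (P i)) := by
    refine le_trans ?_ (Finset.sum_le_sum_of_subset (Finset.erase_subset j _))
    simpa using Finset.card_nsmul_le_sum _ _ 1 hD
  rw [mult_extremalCurve hP]
  have h1 := Nat.mul_le_mul_left (2 * (n + 1) * n) (one_le_mult_horizontalLine (j : k) 1)
  rcases Nat.lt_succ_iff_lt_or_eq.mp hj with hj | rfl
  · rw [Finset.card_erase_of_mem (Finset.mem_range.mpr hj), Finset.card_range,
      Nat.add_sub_cancel] at h2
    have h3 := Nat.mul_le_mul_left (n + 1) ((one_le_mult_pencilLine_middle (j : k)).trans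
      (Finset.single_le_sum (f := fun i : ℕ => mult ((j : k), 1) (pencilLine (i : k)))
        (fun _ _ => Nat.zero_le _) (Finset.mem_range.mpr hj)))
    linarith [Nat.zero_le ((2 * n + 3) * n * mult ((j : k), 1) (horizontalLine (0 : k))),
      Nat.zero_le (n * mult ((j : k), 1) (pencilLine ((n : k) + 1)))]
  · rw [Finset.erase_eq_of_notMem (by simp), Finset.card_range] at h2
    push_cast at h1 h2 ⊢
    have h3 := Nat.mul_le_mul_left n (one_le_mult_pencilLine_middle ((n : k) + 1))
    linarith [Nat.zero_le ((2 * n + 3) * n * mult ((n : k) + 1, 1) (horizontalLine (0 : k))),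
      Nat.zero_le ((n + 1) * ∑ j ∈ Finset.range (n + 1),
        mult ((n : k) + 1, 1) (pencilLine (j : k)))]

theorem le_mult_extremalCurve_even
    (hP : ∀ i < n + 1, IsPencilQuotient (middleParams k n i) (oddParams k n) (P i))
    {j : ℕ} (hj : j < n + 1) :
    2 * n ^ 2 + 4 * n + 1 ≤ mult (2 * (j : k), 0) (extremalCurve n P) := by
  rw [mult_extremalCurve hP]
  have h1 := Nat.mul_le_mul_left ((2 * n + 3) * n) (one_le_mult_horizontalLine (2 * (j : k)) 0)
  have h3 := Nat.mul_le_mul_left (n + 1) ((one_le_mult_pencilLine_bottom (j : k)).trans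
    (Finset.single_le_sum (f := fun i : ℕ => mult (2 * (j : k), 0) (pencilLine (i : k)))
      (fun _ _ => Nat.zero_le _) (Finset.mem_range.mpr hj)))
  linarith [Nat.zero_le (2 * (n + 1) * n * mult (2 * (j : k), 0) (horizontalLine (1 : k))),
    Nat.zero_le (n * mult (2 * (j : k), 0) (pencilLine ((n : k) + 1))),
    Nat.zero_le (∑ i ∈ Finset.range (n + 1),
      mult (2 * (j : k), 0) (rationalCurve (oddParams k n) (P i)))]

theorem le_mult_extremalCurve_odd
    (hP : ∀ i < n + 1, IsPencilQuotient (middleParams k n i) (oddParams k n) (P i))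
    {j : ℕ} (hj : j < n + 1) :
    2 * n ^ 2 + 4 * n + 1 ≤ mult (2 * (j : k) + 1, 0) (extremalCurve n P) := by
  rw [mult_extremalCurve hP]
  have h1 := Nat.mul_le_mul_left ((2 * n + 3) * n) (one_le_mult_horizontalLine (2 * (j : k) + 1) 0)
  have h2 : n + 1 ≤
      ∑ i ∈ Finset.range (n + 1),
        mult (2 * (j : k) + 1, 0) (rationalCurve (oddParams k n) (P i)) := by
    have hmem : (j : k) + 1 / 2 ∈ oddParams k n :=
      Finset.mem_map.mpr ⟨j, Finset.mem_range.mpr hj, rfl⟩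
    have hpt : 2 * (j : k) + 1 = 2 * ((j : k) + 1 / 2) := by ring
    rw [hpt]
    simpa using Finset.card_nsmul_le_sum (Finset.range (n + 1)) _ 1 fun i hi =>
      (hP i (Finset.mem_range.mp hi)).one_le_mult_bottom hmem
  linarith [Nat.zero_le (2 * (n + 1) * n * mult (2 * (j : k) + 1, 0) (horizontalLine (1 : k))),
    Nat.zero_le (n * mult (2 * (j : k) + 1, 0) (pencilLine ((n : k) + 1))),
    Nat.zero_le ((n + 1) * ∑ i ∈ Finset.range (n + 1),
      mult (2 * (j : k) + 1, 0) (pencilLine (i : k)))]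

/-! ### The Waldschmidt constant -/

/-- The affine coordinates of the points of the standard configuration of type
`(1, n + 2, 2 (n + 1))`. -/
noncomputable def configPoints (k : Type*) [Field k] [CharZero k] (n : ℕ) : Finset (k × k) :=
  open Classical in
  {(0, 2)} ∪ (Finset.range (n + 2)).image (fun j : ℕ => ((j : k), 1)) ∪
    (Finset.range (2 * (n + 1))).image (fun j : ℕ => ((j : k), 0))

theorem mem_configPoints (p : k × k) : p ∈ configPoints k n ↔
    p = (0, 2) ∨ (∃ j < n + 2, ((j : k), 1) = p) ∨ ∃ j < 2 * (n + 1), ((j : k), 0) = p := by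
  classical
  simp only [configPoints, Finset.mem_union, Finset.mem_singleton, Finset.mem_image,
    Finset.mem_range, or_assoc]

theorem le_mult_extremalCurve
    (hP : ∀ i < n + 1, IsPencilQuotient (middleParams k n i) (oddParams k n) (P i)) {p : k × k}
    (hp : p ∈ configPoints k n) : 2 * n ^ 2 + 4 * n + 1 ≤ mult p (extremalCurve n P) := by
  rcases (mem_configPoints p).mp hp with rfl | ⟨j, hj, rfl⟩ | ⟨j, hj, rfl⟩
  · exact le_mult_extremalCurve_top hP
  · exact le_mult_extremalCurve_middle hP hj
  · rcases Nat.even_or_odd' j with ⟨i, rfl | rfl⟩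
    · simpa using le_mult_extremalCurve_even hP (show i < n + 1 by omega)
    · simpa using le_mult_extremalCurve_odd hP (show i < n + 1 by omega)

theorem weight_mul_le_weightedMult {F : MvPolynomial (Fin 3) k} {t : ℕ}
    (h : ∀ p ∈ configPoints k n, t ≤ mult p F) :
    (n + 1) * (t * (6 * n ^ 2 + 10 * n + 2)) ≤ weightedMult n F := by
  have ha := h (0, 2) ((mem_configPoints _).mpr (Or.inl rfl))
  have hB : ∀ j < n + 2, t ≤ mult ((j : k), 1) F := fun j hj =>
    h _ ((mem_configPoints _).mpr (Or.inr (Or.inl ⟨j, hj, rfl⟩)))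
  have hC : ∀ j < 2 * (n + 1), t ≤ mult ((j : k), 0) F := fun j hj =>
    h _ ((mem_configPoints _).mpr (Or.inr (Or.inr ⟨j, hj, rfl⟩)))
  have hb := hB (n + 1) (by omega)
  have hBs : (n + 1) * t ≤ middleMult n F := by
    simpa [middleMult] using Finset.card_nsmul_le_sum (Finset.range (n + 1)) _ t fun j hj =>
      hB j (by have := Finset.mem_range.mp hj; omega)
  have hE : (n + 1) * t ≤ evenMult n F := by
    simpa [evenMult] using Finset.card_nsmul_le_sum (Finset.range (n + 1)) _ t fun j hj =>
      hC (2 * j) (by have := Finset.mem_range.mp hj; omega)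
  have hO : (n + 1) * t ≤ oddMult n F := by
    simpa [oddMult] using Finset.card_nsmul_le_sum (Finset.range (n + 1)) _ t fun j hj =>
      hC (2 * j + 1) (by have := Finset.mem_range.mp hj; omega)
  push_cast at hb
  rw [weightedMult]
  have h1 := Nat.mul_le_mul_left (2 * (n + 1) ^ 2 * n) ha
  have h2 := Nat.mul_le_mul_left (2 * (n + 1) * n) hBs
  have h3 := Nat.mul_le_mul_left ((n + 1) * (2 * n + 1)) hb
  have h4 := Nat.mul_le_mul_left (n + 1) hE
  have h5 := Nat.mul_le_mul_left ((2 * n + 3) * n) hO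
  linarith

theorem hasWaldschmidtConstant_configPoints (hn : 1 ≤ n) :
    HasWaldschmidtConstant (idealOfPoints (projPoints (configPoints k n)))
      (((6 * n ^ 2 + 10 * n + 2 : ℕ) : ℝ) / (2 * n ^ 2 + 4 * n + 1 : ℕ)) := by
  have hex : ∀ i, ∃ P : MvPolynomial (Fin 3) k, i < n + 1 →
      IsPencilQuotient (middleParams k n i) (oddParams k n) P := by
    intro i
    by_cases hi : i < n + 1
    · obtain ⟨P, hP⟩ := exists_isPencilQuotient_params k hi
      exact ⟨P, fun _ => hP⟩
    · exact ⟨0, fun h => absurd h hi⟩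
  choose P hP using hex
  refine hasWaldschmidtConstant_of_extremal (Nat.succ_pos _) (extremalCurve_ne_zero hP)
    (extremalCurve_isHomogeneous hP) (fun p hp => le_mult_extremalCurve hP hp) ?_
  intro F d t hF0 hF hFm
  refine Nat.le_of_mul_le_mul_left ?_ n.succ_pos
  rw [← mul_assoc n.succ (2 * n ^ 2 + 4 * n + 1)]
  exact (weight_mul_le_weightedMult hFm).trans (weightedMult_le hn hP d F hF0 hF)

end Configuration

theorem mainTheorem7 {k : Type*} [Field k] [IsAlgClosed k] [CharZero k] (b : ℕ)
    (X : Set (ProjPlane k)) (hX : IsStandardKConfiguration ![1, b, 2 * b - 2] X) :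
    HasWaldschmidtConstant (idealOfPoints X)
      ((6 * (b : ℝ) ^ 2 - 14 * (b : ℝ) + 6) / (2 * (b : ℝ) ^ 2 - 4 * (b : ℝ) + 1)) := by
  have hb : b < 2 * b - 2 := hX.strictMono (show (1 : Fin 3) < 2 by decide)
  obtain ⟨n, rfl⟩ : ∃ n, b = n + 2 := ⟨b - 2, by omega⟩
  have hpts : X = projPoints (configPoints k n) := by
    rw [hX.eq_points]
    ext Q
    simp only [projPoints, Set.mem_ofPred_eq, mem_configPoints]
    have y0 : ((3 : ℕ) : k) - 1 - ((0 : ℕ) : k) = 2 := by norm_num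
    have y1 : ((3 : ℕ) : k) - 1 - ((1 : ℕ) : k) = 1 := by norm_num
    have y2 : ((3 : ℕ) : k) - 1 - ((2 : ℕ) : k) = 0 := by norm_num
    constructor
    · rintro ⟨i, j, hj, rfl⟩
      fin_cases i
      · obtain rfl : j = 0 := Nat.lt_one_iff.mp hj
        exact ⟨(0, 2), Or.inl rfl, congrArg₂ affPoint Nat.cast_zero y0⟩
      · exact ⟨((j : k), 1), Or.inr (Or.inl ⟨j, hj, rfl⟩), congrArg (affPoint _) y1⟩
      · exact ⟨((j : k), 0), Or.inr (Or.inr ⟨j, hj, rfl⟩), congrArg (affPoint _) y2⟩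
    · rintro ⟨p, rfl | ⟨j, hj, rfl⟩ | ⟨j, hj, rfl⟩, rfl⟩
      · exact ⟨0, 0, Nat.one_pos, (congrArg₂ affPoint Nat.cast_zero y0).symm⟩
      · exact ⟨1, j, hj, (congrArg (affPoint _) y1).symm⟩
      · exact ⟨2, j, hj, (congrArg (affPoint _) y2).symm⟩
  rw [hpts]
  convert hasWaldschmidtConstant_configPoints (k := k) (n := n) (by omega) using 1
  push_cast
  congr 1 <;> ring
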